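/- Let $m,n\ge 1$. For an integer $m\times n$ matrix $A$ let $\Sigma_{22}(A)$ be the $(m-1)\times(n-1)$ matrix of the sums of $A$ over all $2\times 2$ windows, $\Sigma_{22}(A)_{ij}=A_{i,j}+A_{i+1,j}+A_{i,j+1}+A_{i+1,j+1}$. The problem with $2\times 2$ window and upper constraints is: given an integer $m\times n$ matrix $U$ and an integer $(m-1)\times(n-1)$ matrix $S$, find an integer $m\times n$ matrix $A$ with $0\le A_{ij}\le U_{ij}$ for all $i,j$ and $\Sigma_{22}(A)=S$, or establish that there is none. Consider a RAM with integer registers and memory cells indexed by the natural numbers, whose instructions (each of cost $1$) are: loading a constant, addition and subtraction of registers, indirect load and store, unconditional jumps, jumps on a positive or on a zero register, and halting. Initially two registers contain $m$ and $n$, the memory contains $U$ and $S$ row by row, and everything else is $0$. Then there is a program, with constants independent of the instance, that solves the problem on every instance in $$O\bigl(mn(m+n)(1+\max(U_{\min},0))\bigr)$$ steps, where $U_{\min}=\min_{i,j}U_{ij}$; for $U\ge 0$ this is $O(mn(m+n)(1+U_{\min}))$. Throughout the computation all numbers in registers and memory have $O(\log(m+n+\max_{i,j}|U_{ij}|+\max_{i,j}|S_{ij}|))$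 bits. In particular, the running time is bounded by a polynomial in the length of the input when the entries of $U$ are written in unary (and those of $S$ in binary). -/

import Mathlib

namespace WindowSums

/-! ### The reconstruction problem -/

/-- The matrix of sums of `A` over all `m' × n'` windows. It has `m - m' + 1` rows and
`n - n' + 1` columns (none at all if the window does not fit). -/
def windowSum {m n : ℕ} (m' n' : ℕ) (A : Matrix (Fin m) (Fin n) ℤ) :
    Matrix (Fin (m + 1 - m')) (Fin (n + 1 - n')) ℤ :=
  fun i j => ∑ a : Fin m', ∑ b : Fin n',
    A ⟨i.1 + a.1, by have := i.2; have := a.2; omega⟩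
      ⟨j.1 + b.1, by have := j.2; have := b.2; omega⟩

/-- `A` solves the problem with `2 × 2` window, sums `S` and upper constraints `U`. -/
def IsSolution {m n : ℕ} (U : Matrix (Fin m) (Fin n) ℤ)
    (S : Matrix (Fin (m + 1 - 2)) (Fin (n + 1 - 2)) ℤ) (A : Matrix (Fin m) (Fin n) ℤ) : Prop :=
  (∀ i j, 0 ≤ A i j ∧ A i j ≤ U i j) ∧ windowSum 2 2 A = S

/-- The least entry of a nonempty integer matrix. -/
def minEntry {m n : ℕ} (hm : 0 < m) (hn : 0 < n) (U : Matrix (Fin m) (Fin n) ℤ) : ℤ :=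
  (Finset.univ : Finset (Fin m × Fin n)).inf' ⟨(⟨0, hm⟩, ⟨0, hn⟩), Finset.mem_univ _⟩
    (fun ij => U ij.1 ij.2)

/-- The largest absolute value of an entry (`0` for an empty matrix). -/
def maxAbs {m n : ℕ} (A : Matrix (Fin m) (Fin n) ℤ) : ℕ :=
  (Finset.univ : Finset (Fin m × Fin n)).sup (fun ij => (A ij.1 ij.2).natAbs)

/-! ### Random access machine -/

/-- Instructions of the machine. `d`, `a`, `b`, `s` are numbers of registers and `l` is the
number of an instruction. -/
inductive Instr
  /-- `reg d := k` -/
  | const (d : ℕ) (k : ℤ)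
  /-- `reg d := reg a + reg b` -/
  | add (d a b : ℕ)
  /-- `reg d := reg a - reg b` -/
  | sub (d a b : ℕ)
  /-- `reg d := mem (reg a)` -/
  | load (d a : ℕ)
  /-- `mem (reg a) := reg s` -/
  | store (a s : ℕ)
  /-- go to instruction `l` -/
  | jump (l : ℕ)
  /-- go to instruction `l` if `reg a > 0` -/
  | jumpPos (a l : ℕ)
  /-- go to instruction `l` if `reg a = 0` -/
  | jumpZero (a l : ℕ)
  /-- stop -/
  | halt

/-- A program is a finite list of instructions, numbered from `0`. It can therefore mention
only finitely many registers; unbounded storage is reached through `load` and `store`. -/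
abbrev Program := List Instr

/-- A configuration: program counter, registers, and memory cells. -/
structure Config where
  pc : ℕ
  reg : ℕ → ℤ
  mem : ℕ → ℤ

/-- Execution of one instruction. There is no next configuration after `halt`, after leaving
the program, and after an access to a negative address. -/
def step (p : Program) (c : Config) : Option Config :=
  match p[c.pc]? with
  | none => none
  | some .halt => none
  | some (.const d k) => some ⟨c.pc + 1, Function.update c.reg d k, c.mem⟩
  | some (.add d a b) => some ⟨c.pc + 1, Function.update c.reg d (c.reg a + c.reg b), c.mem⟩
  | some (.sub d a b) => some ⟨c.pc + 1, Function.update c.reg d (c.reg a - c.reg b), c.mem⟩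
  | some (.load d a) =>
      if 0 ≤ c.reg a then
        some ⟨c.pc + 1, Function.update c.reg d (c.mem (c.reg a).toNat), c.mem⟩
      else none
  | some (.store a s) =>
      if 0 ≤ c.reg a then
        some ⟨c.pc + 1, c.reg, Function.update c.mem (c.reg a).toNat (c.reg s)⟩
      else none
  | some (.jump l) => some ⟨l, c.reg, c.mem⟩
  | some (.jumpPos a l) => some ⟨if 0 < c.reg a then l else c.pc + 1, c.reg, c.mem⟩
  | some (.jumpZero a l) => some ⟨if c.reg a = 0 then l else c.pc + 1, c.reg, c.mem⟩

/-- The configuration after `t` executed instructions, if there is one. -/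
def run (p : Program) (c : Config) : ℕ → Option Config
  | 0 => some c
  | t + 1 => (run p c t).bind (step p)

/-- Every register and every memory cell holds a signed `w`-bit number. -/
def Config.FitsIn (c : Config) (w : ℕ) : Prop :=
  (∀ r, |c.reg r| < 2 ^ w) ∧ (∀ a, |c.mem a| < 2 ^ w)

/-- Started in `c`, the program arrives at a `halt` instruction in configuration `c'` after
executing exactly `T` instructions, and all numbers that occur on the way fit into words of
`w` bits (and a sign). -/
def HaltsIn (p : Program) (w : ℕ) (c : Config) (T : ℕ) (c' : Config) : Prop :=
  run p c T = some c' ∧ p[c'.pc]? = some .halt ∧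
    ∀ t ≤ T, ∀ d, run p c t = some d → d.FitsIn w

/-! ### Input and output -/

/-- The initial memory: the entries of `U` row by row in cells `0, …, mn - 1`, the entries of
`S` row by row in the following cells, and zeros elsewhere. -/
def inputMem {m n k l : ℕ} (U : Matrix (Fin m) (Fin n) ℤ) (S : Matrix (Fin k) (Fin l) ℤ)
    (a : ℕ) : ℤ :=
  if h : a < m * n then U (Fin.divNat ⟨a, h⟩) (Fin.modNat ⟨a, h⟩)
  else if h' : a - m * n < k * l then
    S (Fin.divNat ⟨a - m * n, h'⟩) (Fin.modNat ⟨a - m * n, h'⟩)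
  else 0

/-- The initial configuration: `m` and `n` in registers `0` and `1`, zeros in the other
registers, `U` and `S` in the memory. -/
def inputConfig {m n : ℕ} (U : Matrix (Fin m) (Fin n) ℤ)
    (S : Matrix (Fin (m + 1 - 2)) (Fin (n + 1 - 2)) ℤ) : Config where
  pc := 0
  reg := fun r => if r = 0 then (m : ℤ) else if r = 1 then (n : ℤ) else 0
  mem := inputMem U S

/-- The `m × n` matrix stored row by row in cells `0, …, mn - 1`. -/
def outputMatrix (m n : ℕ) (c : Config) : Matrix (Fin m) (Fin n) ℤ :=
  fun i j => c.mem (i.1 * n + j.1)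

/-- The final configuration answers the instance `(U, S)`: either register `0` contains `1` and
the memory contains a solution, or register `0` contains `0` and there is no solution. -/
def Answers {m n : ℕ} (U : Matrix (Fin m) (Fin n) ℤ)
    (S : Matrix (Fin (m + 1 - 2)) (Fin (n + 1 - 2)) ℤ) (c : Config) : Prop :=
  (c.reg 0 = 1 ∧ IsSolution U S (outputMatrix m n c)) ∨
    (c.reg 0 = 0 ∧ ¬ ∃ A, IsSolution U S A)

/-- The number of bits of the largest number among `m + n` and the entries of `U` and `S`, up to
a constant factor. -/
def instanceBits {m n : ℕ} (U : Matrix (Fin m) (Fin n) ℤ)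
    (S : Matrix (Fin (m + 1 - 2)) (Fin (n + 1 - 2)) ℤ) : ℕ :=
  Nat.size (m + n + maxAbs U + maxAbs S)

/-- The length of the instance when the entries of `U` are written in unary and those of `S` in
binary, with one separator per entry. -/
def unaryLength {m n : ℕ} (U : Matrix (Fin m) (Fin n) ℤ)
    (S : Matrix (Fin (m + 1 - 2)) (Fin (n + 1 - 2)) ℤ) : ℕ :=
  (∑ i, ∑ j, ((U i j).natAbs + 1)) + ∑ i, ∑ j, (Nat.size (S i j).natAbs + 1)

end WindowSums

/-! Matrices with equal `2 × 2` window sums differ by `(-1)^(i+j) * (r i - d j)` for suitable row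
and column offsets (`alternating_offsets`). Start from the unbounded solution `particular` and, at
positions with `i + j` even, replace each entry by its distance to the upper bound. This reflection
preserves the interval `[0, U i j]` and removes the alternation: the instance is solvable iff `0 ≤ u
i j + d j - r i ≤ U i j` for some integers `d j`, `r i`, where `u` is the reflected particular
solution. Eliminating `r` leaves the difference constraints `Feasible` on `d`; given such a `d`, the
minimum of `u i j + d j` over the row serves as `r i`.

Bellman–Ford relaxation from `d = 0` satisfies the constraints after `n` rounds if they can be
satisfied at all (`feasible_offsets`). The `n ^ 2` constraints of a row all use the same row
minimum, so a round costs `O(mn)` and the whole computation `O(mn ^ 2)`. Subtracting the row minima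
and reflecting back then gives a matrix with the right window sums, and it violates a bound only if
there is no solution (`answers_of_outMem`).

All numbers are polynomial in `m + n` plus the largest entries (`small_inputMem`), hence have
logarithmic length. The program is written as a structured command; `Cmd.Exec.reaches` transfers its
time and size bounds to the machine, and `mainCmd_spec` verifies it by loop invariants. -/

namespace WindowSums

/-! ### A structured language for the machine -/

/-- Registers and memory of the machine, without the program counter. -/
structure Store where
  reg : ℕ → ℤ
  mem : ℕ → ℤ

/-- The configuration with the given program counter and store. -/
def Store.at (s : Store) (b : ℕ) : Config := ⟨b, s.reg, s.mem⟩

/-- The store after an assignment to a register. -/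
def Store.setReg (s : Store) (d : ℕ) (v : ℤ) : Store := ⟨Function.update s.reg d v, s.mem⟩

/-- The store after an assignment to a memory cell. -/
def Store.setMem (s : Store) (a : ℕ) (v : ℤ) : Store := ⟨s.reg, Function.update s.mem a v⟩

/-- All numbers in the store are smaller than `B` in absolute value. -/
def Store.Bounded (B : ℤ) (s : Store) : Prop := (∀ r, |s.reg r| < B) ∧ ∀ a, |s.mem a| < B

/-- Structured programs. `subIf g d a b` is the assignment `reg d := reg a - reg b` executed only
if `reg g` is positive, and `loop a c` repeats `c` as long as `reg a` is positive. -/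
inductive Cmd
  | const (d : ℕ) (k : ℤ)
  | add (d a b : ℕ)
  | sub (d a b : ℕ)
  | load (d a : ℕ)
  | store (a s : ℕ)
  | subIf (g d a b : ℕ)
  | seq (c c' : Cmd)
  | loop (a : ℕ) (c : Cmd)

infixr:60 ";;" => Cmd.seq

namespace Cmd

/-- The number of instructions of the compiled command. -/
def len : Cmd → ℕ
  | subIf _ _ _ _ => 3
  | seq c c' => c.len + c'.len
  | loop _ c => c.len + 3
  | _ => 1

/-- The instructions of a command whose first instruction has number `b`. -/
def code : Cmd → ℕ → List Instr
  | const d k, _ => [.const d k]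
  | add d a b, _ => [.add d a b]
  | sub d a b, _ => [.sub d a b]
  | load d a, _ => [.load d a]
  | store a s, _ => [.store a s]
  | subIf g d x y, b => [.jumpPos g (b + 2), .jump (b + 3), .sub d x y]
  | seq c c', b => c.code b ++ c'.code (b + c.len)
  | loop a c, b => [.jumpPos a (b + 2), .jump (b + c.len + 3)] ++ (c.code (b + 2) ++ [.jump b])

theorem length_code (c : Cmd) (b : ℕ) : (c.code b).length = c.len := by
  induction c generalizing b <;> simp_all [code, len]

/-- The registers that a command may change. -/
def mods : Cmd → List ℕ
  | const d _ => [d]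
  | add d _ _ => [d]
  | sub d _ _ => [d]
  | load d _ => [d]
  | store _ _ => []
  | subIf _ d _ _ => [d]
  | seq c c' => c.mods ++ c'.mods
  | loop _ c => c.mods

/-- `c.Exec B s t s'`: the command leads from the store `s` to `s'` in `t` steps, and all computed
numbers are smaller than `B` in absolute value. -/
inductive Exec (B : ℤ) : Cmd → Store → ℕ → Store → Prop
  | const {s : Store} {d : ℕ} {k : ℤ} (h : |k| < B) : Exec B (const d k) s 1 (s.setReg d k)
  | add {s : Store} {d a b : ℕ} (h : |s.reg a + s.reg b| < B) :
      Exec B (add d a b) s 1 (s.setReg d (s.reg a + s.reg b))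
  | sub {s : Store} {d a b : ℕ} (h : |s.reg a - s.reg b| < B) :
      Exec B (sub d a b) s 1 (s.setReg d (s.reg a - s.reg b))
  | load {s : Store} {d a : ℕ} (h : 0 ≤ s.reg a) :
      Exec B (load d a) s 1 (s.setReg d (s.mem (s.reg a).toNat))
  | store {s : Store} {a r : ℕ} (h : 0 ≤ s.reg a) :
      Exec B (store a r) s 1 (s.setMem (s.reg a).toNat (s.reg r))
  | subIf_pos {s : Store} {g d a b : ℕ} (h : 0 < s.reg g) (h' : |s.reg a - s.reg b| < B) :
      Exec B (subIf g d a b) s 2 (s.setReg d (s.reg a - s.reg b))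
  | subIf_neg {s : Store} {g d a b : ℕ} (h : ¬ 0 < s.reg g) : Exec B (subIf g d a b) s 2 s
  | seq {s s' s'' : Store} {t t' : ℕ} {c c' : Cmd} (h : Exec B c s t s')
      (h' : Exec B c' s' t' s'') : Exec B (seq c c') s (t + t') s''
  | loop_exit {s : Store} {a : ℕ} {c : Cmd} (h : ¬ 0 < s.reg a) : Exec B (loop a c) s 2 s
  | loop_step {s s' s'' : Store} {t t' : ℕ} {a : ℕ} {c : Cmd} (h : 0 < s.reg a)
      (hc : Exec B c s t s') (hl : Exec B (loop a c) s' t' s'') :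
      Exec B (loop a c) s (1 + (t + (1 + t'))) s''

/-- Frame property: `mods` is a concrete list, so `decide` shows which constants and addresses
survive a command. -/
theorem Exec.reg_eq {B : ℤ} {c : Cmd} {s s' : Store} {t : ℕ} (h : c.Exec B s t s') :
    ∀ r ∉ c.mods, s'.reg r = s.reg r := by
  induction h with
  | seq _ _ ih ih' =>
    intro r hr
    simp only [mods, List.mem_append, not_or] at hr
    rw [ih' r hr.2, ih r hr.1]
  | loop_step _ _ _ ih ih' =>
    intro r hr
    rw [ih' r hr, ih r hr]
  | _ => intro r hr; simp_all [mods, Store.setReg, Store.setMem]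

end Cmd

theorem Store.Bounded.setReg {B : ℤ} {s : Store} (h : s.Bounded B) {d : ℕ} {v : ℤ} (hv : |v| < B) :
    (s.setReg d v).Bounded B := by
  refine ⟨fun r => ?_, h.2⟩
  rcases eq_or_ne r d with rfl | hr
  · simpa [Store.setReg] using hv
  · simpa [Store.setReg, hr] using h.1 r

theorem Store.Bounded.setMem {B : ℤ} {s : Store} (h : s.Bounded B) {a : ℕ} {v : ℤ} (hv : |v| < B) :
    (s.setMem a v).Bounded B := by
  refine ⟨h.1, fun r => ?_⟩
  rcases eq_or_ne r a with rfl | hr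
  · simpa [Store.setMem] using hv
  · simpa [Store.setMem, hr] using h.2 r

/-- Only computed values need a size check; loads and stores move numbers that are already present.
-/
theorem Cmd.Exec.bounded {B : ℤ} {c : Cmd} {s s' : Store} {t : ℕ} (h : c.Exec B s t s')
    (hs : s.Bounded B) : s'.Bounded B := by
  induction h with
  | seq _ _ ih ih' => exact ih' (ih hs)
  | loop_step _ _ _ ih ih' => exact ih' (ih hs)
  | const h => exact hs.setReg h
  | add h => exact hs.setReg h
  | sub h => exact hs.setReg h
  | load h => exact hs.setReg (hs.2 _)
  | store h => exact hs.setMem (hs.1 _)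
  | subIf_pos _ h => exact hs.setReg h
  | subIf_neg _ => exact hs
  | loop_exit _ => exact hs

/-! ### Correctness of the compilation -/

/-- The instructions `l` occur in `p` from number `b` on. -/
def HasCode (p : Program) (b : ℕ) (l : List Instr) : Prop :=
  ∃ x y, p = x ++ (l ++ y) ∧ x.length = b

theorem HasCode.append {p : Program} {b : ℕ} {l l' : List Instr} (h : HasCode p b (l ++ l')) :
    HasCode p b l ∧ HasCode p (b + l.length) l' := by
  obtain ⟨x, y, rfl, rfl⟩ := h
  exact ⟨⟨x, l' ++ y, by simp, rfl⟩, ⟨x ++ l, y, by simp, by simp⟩⟩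

theorem HasCode.getElem? {p : Program} {b : ℕ} {l : List Instr} (h : HasCode p b l) {i : ℕ}
    (hi : i < l.length) : p[b + i]? = l[i]? := by
  obtain ⟨x, y, rfl, rfl⟩ := h
  rw [List.getElem?_append_right (by omega), Nat.add_sub_cancel_left,
    List.getElem?_append_left hi]

theorem HasCode.getElem?_zero {p : Program} {b : ℕ} {l : List Instr} {i : Instr}
    (h : HasCode p b (i :: l)) : p[b]? = some i := by
  simpa using h.getElem? (i := 0) (by simp)

/-- The program leads from `c` to `c'` in `t` steps, and all numbers on the way fit into `w`
bits. -/
def Reaches (p : Program) (w : ℕ) (c : Config) (t : ℕ) (c' : Config) : Prop :=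
  run p c t = some c' ∧ ∀ s ≤ t, ∀ d, run p c s = some d → d.FitsIn w

theorem run_add (p : Program) (c : Config) (s t : ℕ) :
    run p c (s + t) = (run p c s).bind (fun d => run p d t) := by
  induction t with
  | zero => simp [run]
  | succ t ih => rw [← add_assoc, run, ih, Option.bind_assoc]; rfl

theorem Reaches.trans {p : Program} {w s t : ℕ} {c d e : Config} (h : Reaches p w c s d)
    (h' : Reaches p w d t e) : Reaches p w c (s + t) e := by
  refine ⟨by rw [run_add, h.1]; exact h'.1, fun r hr f hf => ?_⟩
  rcases le_total r s with hrs | hrs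
  · exact h.2 r hrs f hf
  · obtain ⟨q, rfl⟩ := Nat.exists_eq_add_of_le hrs
    rw [run_add, h.1] at hf
    exact h'.2 q (by omega) f hf

theorem Store.Bounded.fitsIn {w : ℕ} {s : Store} (h : s.Bounded (2 ^ w)) (b : ℕ) :
    (s.at b).FitsIn w := h

theorem Reaches.of_step {p : Program} {w b b' : ℕ} {s s' : Store}
    (h : step p (s.at b) = some (s'.at b')) (hs : s.Bounded (2 ^ w)) (hs' : s'.Bounded (2 ^ w)) :
    Reaches p w (s.at b) 1 (s'.at b') := by
  have h1 : run p (s.at b) 1 = some (s'.at b') := by simp [run, h]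
  refine ⟨h1, fun r hr f hf => ?_⟩
  interval_cases r
  · simp only [run, Option.some.injEq] at hf
    exact hf ▸ hs.fitsIn b
  · rw [h1, Option.some.injEq] at hf
    exact hf ▸ hs'.fitsIn b'

/-- Induction on the execution. The step counts of `Exec` include the jumps, so the times agree
exactly; the closing jump of a loop leads back to `b`, where the hypothesis for the remaining
iterations applies. -/
theorem Cmd.Exec.reaches {p : Program} {w : ℕ} {c : Cmd} {s s' : Store} {t : ℕ}
    (h : c.Exec (2 ^ w) s t s') (hs : s.Bounded (2 ^ w)) :
    ∀ b, HasCode p b (c.code b) → Reaches p w (s.at b) t (s'.at (b + c.len)) := by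
  induction h with
  | const h =>
    intro b hb
    exact .of_step (by simp [step, Store.at, (HasCode.getElem?_zero hb), Store.setReg, Cmd.len])
      hs (hs.setReg h)
  | add h =>
    intro b hb
    exact .of_step (by simp [step, Store.at, (HasCode.getElem?_zero hb), Store.setReg, Cmd.len])
      hs (hs.setReg h)
  | sub h =>
    intro b hb
    exact .of_step (by simp [step, Store.at, (HasCode.getElem?_zero hb), Store.setReg, Cmd.len])
      hs (hs.setReg h)
  | load h =>
    intro b hb
    exact .of_step (by simp [step, Store.at, (HasCode.getElem?_zero hb), Store.setReg, Cmd.len, h])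
      hs (hs.setReg (hs.2 _))
  | store h =>
    intro b hb
    exact .of_step (by simp [step, Store.at, (HasCode.getElem?_zero hb), Store.setMem, Cmd.len, h])
      hs (hs.setMem (hs.1 _))
  | @subIf_pos s g d x y h h' =>
    intro b hb
    have h0 := HasCode.getElem?_zero hb
    have h2 : p[b + 2]? = some (.sub d x y) := by
      simpa [Cmd.code] using hb.getElem? (i := 2) (by simp [Cmd.code])
    refine (Reaches.of_step (b' := b + 2) (s' := s) ?_ hs hs).trans
      (t := 1) (.of_step ?_ hs (hs.setReg h'))
    · simp [step, Store.at, h0, h]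
    · simp [step, Store.at, h2, Store.setReg, Cmd.len]
  | @subIf_neg s g d x y h =>
    intro b hb
    have h0 := HasCode.getElem?_zero hb
    have h1 : p[b + 1]? = some (.jump (b + 3)) := by
      simpa [Cmd.code] using hb.getElem? (i := 1) (by simp [Cmd.code])
    refine (Reaches.of_step (b' := b + 1) (s' := s) ?_ hs hs).trans (t := 1) (.of_step ?_ hs hs)
    · simp [step, Store.at, h0, h]
    · simp [step, Store.at, h1, Cmd.len]
  | seq h h' ih ih' =>
    intro b hb
    have hb' := HasCode.append hb
    rw [Cmd.length_code] at hb'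
    rw [Cmd.len, ← add_assoc]
    exact (ih hs b hb'.1).trans (ih' (h.bounded hs) _ hb'.2)
  | @loop_exit s a c h =>
    intro b hb
    have h0 := HasCode.getElem?_zero hb
    have h1 : p[b + 1]? = some (.jump (b + c.len + 3)) := by
      simpa [Cmd.code] using hb.getElem? (i := 1) (by simp [Cmd.code])
    refine (Reaches.of_step (b' := b + 1) (s' := s) ?_ hs hs).trans (t := 1) (.of_step ?_ hs hs)
    · simp [step, Store.at, h0, h]
    · simp [step, Store.at, h1, Cmd.len, add_assoc]
  | @loop_step s s' s'' t t' a c h hc hl ih ih' =>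
    intro b hb
    have h0 := HasCode.getElem?_zero hb
    have h1 := (HasCode.append hb).2
    have h2 := h1.append
    have h3 : p[b + 2 + (c.code (b + 2)).length]? = _ := HasCode.getElem?_zero h2.2
    rw [Cmd.length_code] at h3
    have hs' := hc.bounded hs
    refine (Reaches.of_step (b' := b + 2) (s' := s) ?_ hs hs).trans
      ((ih hs (b + 2) h2.1).trans ((Reaches.of_step (b' := b) (s' := s') ?_ hs' hs').trans
        (ih' hs' b hb)))
    · simp [step, Store.at, h0, h]
    · simp [step, Store.at, h3]

/-! ### Specifications -/

/-- Started in `s`, the command ends after at most `T` steps in a store with property `Q`. -/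
def Cmd.Spec (B : ℤ) (c : Cmd) (s : Store) (T : ℕ) (Q : Store → Prop) : Prop :=
  ∃ t ≤ T, ∃ s', c.Exec B s t s' ∧ Q s'

namespace Cmd

theorem Spec.mono {B : ℤ} {c : Cmd} {s : Store} {T T' : ℕ} {Q Q' : Store → Prop}
    (h : c.Spec B s T Q) (hT : T ≤ T') (hQ : ∀ s', Q s' → Q' s') : c.Spec B s T' Q' := by
  obtain ⟨t, ht, s', he, hq⟩ := h
  exact ⟨t, ht.trans hT, s', he, hQ s' hq⟩

theorem Spec.weaken {B : ℤ} {c : Cmd} {s : Store} {T T' : ℕ} {Q : Store → Prop}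
    (h : c.Spec B s T Q) (hT : T ≤ T') : c.Spec B s T' Q :=
  h.mono hT fun _ => id

theorem Spec.seq {B : ℤ} {c c' : Cmd} {s : Store} {T T' : ℕ} {Q Q' : Store → Prop}
    (h : c.Spec B s T Q)
    (h' : ∀ s', Q s' → (∀ r ∉ c.mods, s'.reg r = s.reg r) → c'.Spec B s' T' Q') :
    (c ;; c').Spec B s (T + T') Q' := by
  obtain ⟨t, ht, s', he, hq⟩ := h
  obtain ⟨t', ht', s'', he', hq'⟩ := h' s' hq he.reg_eq
  exact ⟨t + t', by omega, s'', .seq he he', hq'⟩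

/-- The rule for a loop with counter `reg k` that is executed `N` times, with invariant `I`. -/
theorem Spec.loop {B : ℤ} {c : Cmd} {s : Store} {k N T : ℕ} (hk : s.reg k = N)
    (I : ℕ → Store → Prop) (h0 : I 0 s)
    (hstep : ∀ i < N, ∀ s', I i s' → (∀ r ∉ c.mods, s'.reg r = s.reg r) →
      s'.reg k = N - i → c.Spec B s' T (fun s'' => I (i + 1) s'' ∧ s''.reg k = s'.reg k - 1)) :
    (Cmd.loop k c).Spec B s (N * (T + 2) + 2) (I N) := by
  -- Induction on the number `l` of remaining iterations. Each adds an entry test and a backward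
  -- jump to its body, and leaving the loop costs two steps.
  have key : ∀ l i, i + l = N → ∀ s', I i s' → (∀ r ∉ c.mods, s'.reg r = s.reg r) →
      s'.reg k = l → (Cmd.loop k c).Spec B s' (l * (T + 2) + 2) (I N) := by
    intro l
    induction l with
    | zero =>
      intro i hi s' hI _ hl
      obtain rfl : i = N := by omega
      exact ⟨2, by omega, s', .loop_exit (by simp [hl]), hI⟩
    | succ l ih =>
      intro i hi s' hI hf hl
      obtain ⟨t, ht, s'', he, hI', hk'⟩ := hstep i (by omega) s' hI hf (by omega)
      obtain ⟨t', ht', s₃, he', hI₃⟩ := ih (i + 1) (by omega) s'' hI'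
        (fun r hr => by rw [he.reg_eq r hr, hf r hr]) (by rw [hk', hl]; push_cast; ring)
      refine ⟨1 + (t + (1 + t')), ?_, s₃, .loop_step (by rw [hl]; positivity) he he', hI₃⟩
      rw [Nat.succ_mul]
      omega
  exact key N 0 (by omega) s h0 (fun _ _ => rfl) hk

/-- Weakest preconditions of commands without loops. -/
def wp (B : ℤ) : Cmd → (Store → Prop) → Store → Prop
  | const d k, Q, s => |k| < B ∧ Q (s.setReg d k)
  | add d a b, Q, s => |s.reg a + s.reg b| < B ∧ Q (s.setReg d (s.reg a + s.reg b))
  | sub d a b, Q, s => |s.reg a - s.reg b| < B ∧ Q (s.setReg d (s.reg a - s.reg b))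
  | load d a, Q, s => 0 ≤ s.reg a ∧ Q (s.setReg d (s.mem (s.reg a).toNat))
  | store a r, Q, s => 0 ≤ s.reg a ∧ Q (s.setMem (s.reg a).toNat (s.reg r))
  -- Writing back the old value merges the two branches into one assignment.
  | subIf g d a b, Q, s => (0 < s.reg g → |s.reg a - s.reg b| < B) ∧
      Q (s.setReg d (if 0 < s.reg g then s.reg a - s.reg b else s.reg d))
  | seq c c', Q, s => c.wp B (c'.wp B Q) s
  | loop _ _, _, _ => False

theorem wp_spec {B : ℤ} {c : Cmd} {Q : Store → Prop} {s : Store} (h : c.wp B Q s) :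
    c.Spec B s c.len Q := by
  induction c generalizing Q s with
  | const d k => exact ⟨1, le_rfl, _, .const h.1, h.2⟩
  | add d a b => exact ⟨1, le_rfl, _, .add h.1, h.2⟩
  | sub d a b => exact ⟨1, le_rfl, _, .sub h.1, h.2⟩
  | load d a => exact ⟨1, le_rfl, _, .load h.1, h.2⟩
  | store a r => exact ⟨1, le_rfl, _, .store h.1, h.2⟩
  | subIf g d a b =>
    by_cases hg : 0 < s.reg g
    · exact ⟨2, by simp [len], _, .subIf_pos hg (h.1 hg), by simpa [hg] using h.2⟩
    · refine ⟨2, by simp [len], _, .subIf_neg hg, ?_⟩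
      simpa [hg, Store.setReg] using h.2
  | seq c c' ih ih' => exact (ih h).seq (fun s' hs' _ => ih' hs')
  | loop a c => exact h.elim

theorem Spec.of_wp {B : ℤ} {c : Cmd} {Q : Store → Prop} {s : Store} {T : ℕ} (h : c.wp B Q s)
    (hT : c.len ≤ T) : c.Spec B s T Q :=
  (wp_spec h).weaken hT

end Cmd

end WindowSums

namespace WindowSums

/-! ### Relaxation of difference constraints -/

/-- The constraints on the column offsets `d`: for suitable row offsets `r`, all numbers
`u i j + d j - r i` lie between `0` and `U i j`. -/
def Feasible (m n : ℕ) (u U : ℕ → ℕ → ℤ) (d : ℕ → ℤ) : Prop :=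
  ∀ i < m, ∀ j < n, ∀ j' < n, d j' ≤ d j + u i j - u i j' + U i j'

/-- If the constraints are feasible, then every sequence of relaxations that starts at `0`
satisfies them after `n` rounds. -/
theorem feasible_of_relaxation {m n : ℕ} {u U : ℕ → ℕ → ℤ} {c : ℕ → ℕ → ℤ}
    (h0 : ∀ j < n, c 0 j = 0) (hanti : ∀ t, ∀ j < n, c (t + 1) j ≤ c t j)
    (hrelax : ∀ t, ∀ i < m, ∀ j < n, ∀ j' < n, c (t + 1) j' ≤ c t j + u i j - u i j' + U i j')
    (hlow : ∀ d, Feasible m n u U d → ∀ t, (∀ j < n, d j ≤ c t j) → ∀ j < n, d j ≤ c (t + 1) j)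
    (hex : ∃ d, Feasible m n u U d) : Feasible m n u U (c n) := by
  classical
  -- Feasibility is unchanged by a common shift, so nonpositive feasible offsets exist; `d` is
  -- chosen among them with the greatest sum.
  let P : ℤ → Prop := fun z => ∃ d, Feasible m n u U d ∧ (∀ j < n, d j ≤ 0) ∧
    ∑ j ∈ Finset.range n, d j = z
  have hP : ∃ z, P z := by
    obtain ⟨d, hd⟩ := hex
    let K := ∑ j ∈ Finset.range n, |d j|
    refine ⟨_, fun j => d j - K, fun i hi j hj j' hj' => ?_, fun j hj => ?_, rfl⟩
    · have := hd i hi j hj j' hj'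
      dsimp only
      linarith
    · have h1 : |d j| ≤ K := Finset.single_le_sum (f := fun j => |d j|)
        (fun _ _ => abs_nonneg _) (Finset.mem_range.2 hj)
      have h2 := le_abs_self (d j)
      dsimp only
      linarith
  obtain ⟨z, ⟨d, hd, hneg, hsum⟩, hmax⟩ := Int.exists_greatest_of_bdd (P := P)
    ⟨0, fun z ⟨d, _, h1, h2⟩ => h2 ▸ Finset.sum_nonpos fun j hj => h1 j (Finset.mem_range.1 hj)⟩ hP
  have hle : ∀ t, ∀ j < n, d j ≤ c t j := by
    intro t
    induction t with
    | zero => intro j hj; rw [h0 j hj]; exact hneg j hj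
    | succ t ih => exact hlow d hd t ih
  -- A column is settled once it has come down to `d`. Each round settles another one until all are
  -- settled.
  have hsettled : ∀ t ≤ n, t ≤ ((Finset.range n).filter fun j => c t j = d j).card := by
    intro t
    induction t with
    | zero => intro _; exact Nat.zero_le _
    | succ t ih =>
      intro ht
      have ih := ih (by omega)
      have hsub : ((Finset.range n).filter fun j => c t j = d j) ⊆
          (Finset.range n).filter fun j => c (t + 1) j = d j := by
        intro j hj
        rw [Finset.mem_filter, Finset.mem_range] at hj ⊢
        exact ⟨hj.1, le_antisymm ((hanti t j hj.1).trans hj.2.le) (hle _ j hj.1)⟩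
      by_cases hall : ∀ j < n, c t j = d j
      · have : (Finset.range n).filter (fun j => c (t + 1) j = d j) = Finset.range n := by
          refine Finset.filter_true_of_mem fun j hj => ?_
          have hj := Finset.mem_range.1 hj
          exact le_antisymm ((hanti t j hj).trans (hall j hj).le) (hle _ j hj)
        rw [this, Finset.card_range]
        exact ht
      · suffices ∃ j < n, c t j ≠ d j ∧ c (t + 1) j = d j by
          obtain ⟨j, hj, h1, h2⟩ := this
          have : ((Finset.range n).filter fun j => c t j = d j).card <
              ((Finset.range n).filter fun j => c (t + 1) j = d j).card := by
            refine Finset.card_lt_card (Finset.ssubset_iff_of_subset hsub |>.2 ⟨j, ?_, ?_⟩)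
            · simp [hj, h2]
            · simp [h1]
          omega
        by_contra! hno
        push Not at hall
        obtain ⟨k, hk, hck⟩ := hall
        -- If no column is newly settled, raising `d` by one on the unsettled columns keeps it
        -- feasible and nonpositive, against maximality. Only constraints from a settled `j` to an
        -- unsettled `j'` are at stake, and there the relaxed value lies strictly above `d j'`.
        let e : ℕ → ℤ := fun j => if c t j = d j then d j else d j + 1
        have he : P (∑ j ∈ Finset.range n, e j) := by
          refine ⟨e, fun i hi j hj j' hj' => ?_, fun j hj => ?_, rfl⟩
          · have h1 := hd i hi j hj j' hj'
            by_cases hj1 : c t j = d j <;> by_cases hj2 : c t j' = d j' <;>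
              simp only [e, hj1, hj2, if_true, if_false]
            · exact h1
            · have h2 := hrelax t i hi j hj j' hj'
              have h3 := lt_of_le_of_ne (hle (t + 1) j' hj') (hno j' hj' hj2).symm
              omega
            · omega
            · omega
          · by_cases hj1 : c t j = d j <;> simp only [e, hj1, if_true, if_false]
            · exact hneg j hj
            · have h2 : ∀ s, c s j ≤ 0 := by
                intro s
                induction s with
                | zero => exact (h0 j hj).le
                | succ s ih => exact (hanti s j hj).trans ih
              have h3 := lt_of_le_of_ne (hle t j hj) (Ne.symm hj1)
              have h4 := h2 t
              omega
        have h1 := hmax _ he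
        rw [← hsum] at h1
        refine absurd h1 (not_le.2 (Finset.sum_lt_sum (fun j _ => ?_)
          ⟨k, Finset.mem_range.2 hk, ?_⟩))
        · by_cases hj1 : c t j = d j <;> simp [e, hj1]
        · simp [e, hck]
  have hn := hsettled n le_rfl
  have hfull : (Finset.range n).filter (fun j => c n j = d j) = Finset.range n :=
    Finset.eq_of_subset_of_card_le (Finset.filter_subset _ _) (by simpa using hn)
  have heq : ∀ j < n, c n j = d j := fun j hj => by
    have : j ∈ (Finset.range n).filter (fun j => c n j = d j) := by
      rw [hfull]; exact Finset.mem_range.2 hj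
    exact (Finset.mem_filter.1 this).2
  intro i hi j hj j' hj'
  rw [heq j hj, heq j' hj']
  exact hd i hi j hj j' hj'

/-! ### The relaxation carried out by the program -/

section Relax

variable (n : ℕ) (u U : ℕ → ℕ → ℤ)

/-- The minimum of `u i 0 + c 0` and all `u i j + c j` with `j < k`. -/
def rowMin (c : ℕ → ℤ) (i : ℕ) : ℕ → ℤ
  -- Starting from the first entry replaces an infinite initial value and does not change the
  -- minimum for `k ≥ 1`.
  | 0 => u i 0 + c 0
  | k + 1 => min (rowMin c i k) (u i k + c k)

/-- The relaxation of all constraints that belong to row `i`. -/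
def relaxRow (i : ℕ) (c : ℕ → ℤ) (j : ℕ) : ℤ :=
  min (c j) (rowMin u c i n - u i j + U i j)

/-- The relaxation of the constraints of the first `k` rows, one after the other. -/
def relaxRows (c : ℕ → ℤ) : ℕ → ℕ → ℤ
  | 0 => c
  | k + 1 => relaxRow n u U k (relaxRows c k)

/-- The column offsets after `t` rounds of relaxation. -/
def offsets (m : ℕ) : ℕ → ℕ → ℤ
  | 0 => 0
  | t + 1 => relaxRows n u U (offsets m t) m

variable {n u U}

theorem rowMin_le {c : ℕ → ℤ} {i j k : ℕ} (hj : j < k) : rowMin u c i k ≤ u i j + c j := by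
  induction k with
  | zero => omega
  | succ k ih =>
    rw [rowMin]
    rcases Nat.lt_succ_iff_lt_or_eq.1 hj with h | rfl
    · exact (min_le_left _ _).trans (ih h)
    · exact min_le_right _ _

theorem rowMin_eq (c : ℕ → ℤ) (i : ℕ) {n k : ℕ} (hk : k ≤ n) (hn : 0 < n) :
    ∃ j < n, rowMin u c i k = u i j + c j := by
  induction k with
  | zero => exact ⟨0, hn, rfl⟩
  | succ k ih =>
    rw [rowMin]
    rcases min_choice (rowMin u c i k) (u i k + c k) with h | h
    · rw [h]; exact ih (by omega)
    · rw [h]; exact ⟨k, by omega, rfl⟩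

theorem relaxRow_le (i : ℕ) (c : ℕ → ℤ) (j : ℕ) : relaxRow n u U i c j ≤ c j := min_le_left _ _

theorem relaxRows_anti (c : ℕ → ℤ) (j : ℕ) : Antitone (fun k => relaxRows n u U c k j) :=
  antitone_nat_of_succ_le fun _ => relaxRow_le _ _ _

/-- Offsets only decrease, both before and after row `i` is handled, so relaxing in place is at
least as strong as relaxing against `c`. -/
theorem relaxRows_le {m i j j' : ℕ} (c : ℕ → ℤ) (hi : i < m) (hj : j < n) :
    relaxRows n u U c m j' ≤ c j + u i j - u i j' + U i j' := by
  have h1 : relaxRows n u U c m j' ≤ relaxRows n u U c (i + 1) j' := relaxRows_anti c j' hi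
  have h2 : relaxRows n u U c (i + 1) j' ≤
    rowMin u (relaxRows n u U c i) i n - u i j' + U i j' := min_le_right _ _
  have h3 : rowMin u (relaxRows n u U c i) i n ≤ u i j + relaxRows n u U c i j := rowMin_le hj
  have h4 : relaxRows n u U c i j ≤ c j := relaxRows_anti c j (Nat.zero_le i)
  linarith

/-- The row minimum is attained, so each new value is an old one or the right side of an actual
constraint; both stay above `d`. -/
theorem le_relaxRows {m : ℕ} (hn : 0 < n) {c d : ℕ → ℤ} (hd : Feasible m n u U d)
    (hdc : ∀ j < n, d j ≤ c j) {k : ℕ} (hk : k ≤ m) : ∀ j < n, d j ≤ relaxRows n u U c k j := by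
  induction k with
  | zero => exact hdc
  | succ k ih =>
    intro j hj
    have ih := ih (by omega)
    refine le_min (ih j hj) ?_
    obtain ⟨j', hj', h⟩ := rowMin_eq (u := u) (relaxRows n u U c k) k le_rfl hn
    have h1 := hd k (by omega) j' hj' j hj
    have h2 := ih j' hj'
    rw [h]
    linarith

theorem feasible_offsets {m : ℕ} (hn : 0 < n) (hex : ∃ d, Feasible m n u U d) :
    Feasible m n u U (offsets n u U m n) := by
  refine feasible_of_relaxation (c := offsets n u U m) (fun _ _ => rfl) ?_ ?_ ?_ hex
  · exact fun t j _ => relaxRows_anti (offsets n u U m t) j (Nat.zero_le m)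
  · exact fun t i hi j hj j' _ => relaxRows_le _ hi hj
  · exact fun d hd t h => le_relaxRows hn hd h le_rfl

/-! ### Growth of the offsets -/

theorem abs_rowMin_le {c : ℕ → ℤ} {i k : ℕ} {X Y : ℤ} (hk : k ≤ n) (hn : 0 < n)
    (hu : ∀ j < n, |u i j| ≤ X) (hc : ∀ j < n, |c j| ≤ Y) : |rowMin u c i k| ≤ X + Y := by
  obtain ⟨j, hj, h⟩ := rowMin_eq (u := u) c i hk hn
  rw [h]
  exact (abs_add_le _ _).trans (add_le_add (hu j hj) (hc j hj))

/-- The three `X` come from the entry in the row minimum, the subtracted entry and the upper bound.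
-/
theorem abs_relaxRow_le {c : ℕ → ℤ} {i : ℕ} {X Y : ℤ} (hn : 0 < n)
    (hu : ∀ j < n, |u i j| ≤ X) (hU : ∀ j < n, |U i j| ≤ X) (hc : ∀ j < n, |c j| ≤ Y) :
    ∀ j < n, |relaxRow n u U i c j| ≤ Y + 3 * X := by
  intro j hj
  have h1 := abs_rowMin_le le_rfl hn hu hc
  have h2 := hu j hj
  have h3 := hU j hj
  have h4 := hc j hj
  rw [relaxRow]
  rw [abs_le] at *
  rcases min_cases (c j) (rowMin u c i n - u i j + U i j) with ⟨h, _⟩ | ⟨h, _⟩ <;> rw [h] <;>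
    constructor <;> linarith

theorem abs_relaxRows_le {m : ℕ} {c : ℕ → ℤ} {X Y : ℤ} (hn : 0 < n)
    (hu : ∀ i < m, ∀ j < n, |u i j| ≤ X) (hU : ∀ i < m, ∀ j < n, |U i j| ≤ X)
    (hc : ∀ j < n, |c j| ≤ Y) {k : ℕ} (hk : k ≤ m) :
    ∀ j < n, |relaxRows n u U c k j| ≤ Y + k * (3 * X) := by
  induction k with
  | zero => simpa [relaxRows] using hc
  | succ k ih =>
    intro j hj
    have := abs_relaxRow_le hn (hu k (by omega)) (hU k (by omega)) (ih (by omega)) j hj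
    rw [relaxRows]
    push_cast
    linarith

theorem abs_offsets_le {m : ℕ} {X : ℤ} (hn : 0 < n)
    (hu : ∀ i < m, ∀ j < n, |u i j| ≤ X) (hU : ∀ i < m, ∀ j < n, |U i j| ≤ X) (t : ℕ) :
    ∀ j < n, |offsets n u U m t j| ≤ t * (m * (3 * X)) := by
  induction t with
  | zero => intro j _; simp [offsets]
  | succ t ih =>
    intro j hj
    have := abs_relaxRows_le hn hu hU ih le_rfl j hj
    rw [offsets]
    push_cast
    linarith

end Relax

/-! ### A matrix with given window sums -/

section Particular

variable (S : ℕ → ℕ → ℤ)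

/-- The sums over the `2 × 1` windows of `particular`. -/
def pairSum (i : ℕ) : ℕ → ℤ
  | 0 => 0
  | j + 1 => S i j - pairSum i j

/-- An integer matrix with window sums `S`, not subject to any bounds. -/
def particular : ℕ → ℕ → ℤ
  | 0, _ => 0
  | i + 1, j => pairSum S i j - particular i j

variable {S}

/-- Vertically adjacent entries of `particular` add up to `pairSum`, and adjacent pair sums add up
to `S`. -/
theorem particular_window (i j : ℕ) :
    particular S i j + particular S (i + 1) j + particular S i (j + 1) +
      particular S (i + 1) (j + 1) = S i j := by
  simp only [particular, pairSum]
  ring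

theorem abs_pairSum_le {M : ℤ} {i : ℕ} (hS : ∀ j, |S i j| ≤ M) (j : ℕ) :
    |pairSum S i j| ≤ j * M := by
  induction j with
  | zero => simp [pairSum]
  | succ j ih =>
    rw [pairSum]
    have := abs_sub (S i j) (pairSum S i j)
    have := hS j
    push_cast
    linarith

theorem abs_particular_le {M : ℤ} (hS : ∀ i j, |S i j| ≤ M) (i j : ℕ) :
    |particular S i j| ≤ i * (j * M) := by
  induction i with
  | zero => simp [particular]
  | succ i ih =>
    rw [particular]
    have := abs_sub (pairSum S i j) (particular S i j)
    have := abs_pairSum_le (hS i) j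
    push_cast
    linarith

/-- Two matrices with the same window sums differ by row and column offsets with alternating
signs. -/
theorem alternating_offsets {m n : ℕ} {E : ℕ → ℕ → ℤ}
    (hE : ∀ i j, i + 1 < m → j + 1 < n →
      E i j + E (i + 1) j + E i (j + 1) + E (i + 1) (j + 1) = 0) :
    ∀ i < m, ∀ j < n, (-1) ^ (i + j) * E i j =
      (-1) ^ i * E i 0 + (-1) ^ j * E 0 j - E 0 0 := by
  -- Sums of vertical pairs change sign from column to column; the outer induction then descends the
  -- rows.
  have h1 : ∀ i, i + 1 < m → ∀ j < n, E i j + E (i + 1) j = (-1) ^ j * (E i 0 + E (i + 1) 0) := by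
    intro i hi j
    induction j with
    | zero => simp
    | succ j ih =>
      intro hj
      have h2 := ih (by omega)
      have h3 := hE i j hi hj
      rw [pow_succ]
      linarith
  intro i
  induction i with
  | zero => intro _ j _; simp
  | succ i ih =>
    intro hi j hj
    have h2 := ih (by omega) j hj
    have h3 := h1 i hi j hj
    have h4 : (-1 : ℤ) ^ j * (-1) ^ j = 1 := by rw [← mul_pow]; simp
    have h5 : E (i + 1) j = (-1) ^ j * (E i 0 + E (i + 1) 0) - E i j := by linarith
    rw [h5, pow_add, pow_add, pow_one]
    rw [pow_add] at h2
    linear_combination h2 - (-1) ^ i * (E i 0 + E (i + 1) 0) * h4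

end Particular

end WindowSums

namespace WindowSums

open Cmd

/-! ### The program

Register `1` holds `n`, registers `2` and `3` hold `0` and `1`, register `4` holds `m * n`.
Registers `19` and `20` hold the addresses of the column offsets and of a row of auxiliary
entries; registers `7`–`11` and `23` are running pointers and `5`, `6`, `21` loop counters. -/

/-- Loop body: take the next entry of a row into account in the minimum. -/
def minStep : Cmd :=
  load 15 23 ;; load 16 9 ;; add 15 15 16 ;; sub 16 14 15 ;; subIf 16 14 15 2 ;;
  add 23 23 3 ;; add 9 9 3 ;; sub 6 6 3

/-- Put the minimum of a row, with the column offsets added, into register `14`. -/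
def minRow : Cmd :=
  (add 23 8 2 ;; add 9 19 2 ;; load 15 23 ;; load 16 9 ;; add 14 15 16 ;; add 6 1 2) ;;
  loop 6 minStep

/-- The hypothesis `8 * H < B` recurs below: every computed value combines only a few numbers of
size at most `H`. -/
theorem minRow_spec {B H : ℤ} {n i x y : ℕ} {u : ℕ → ℕ → ℤ} {c : ℕ → ℤ} {s : Store} (hn : 0 < n)
    (hB : 8 * H < B) (hu : ∀ j < n, |u i j| ≤ H) (hc : ∀ j < n, |c j| ≤ H)
    (hx : ((x + n : ℕ) : ℤ) ≤ H) (hy : ((y + n : ℕ) : ℤ) ≤ H)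
    (h1 : s.reg 1 = n) (h2 : s.reg 2 = 0) (h3 : s.reg 3 = 1) (h8 : s.reg 8 = (x : ℕ))
    (h19 : s.reg 19 = (y : ℕ)) (hxm : ∀ j < n, s.mem (x + j) = u i j)
    (hym : ∀ j < n, s.mem (y + j) = c j) :
    minRow.Spec B s (12 * n + 8) (fun s' => s'.reg 14 = rowMin u c i n ∧ s'.mem = s.mem) := by
  refine (Spec.seq (T := 6) (T' := n * (10 + 2) + 2)
    (Q := fun s' => s'.reg 14 = rowMin u c i 0 ∧ s'.mem = s.mem ∧ s'.reg 6 = n ∧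
      s'.reg 23 = (x : ℕ) ∧ s'.reg 9 = (y : ℕ)) (.of_wp ?_ (by decide)) ?_).weaken (by omega)
  · have hu0 := abs_le.1 (hu 0 hn)
    have hc0 := abs_le.1 (hc 0 hn)
    have hxm0 := hxm 0 hn
    have hym0 := hym 0 hn
    rw [add_zero] at hxm0 hym0
    simp only [wp, Store.setReg, Function.update_apply, Nat.reduceEqDiff, if_true, if_false,
      h1, h2, h8, h19, Int.toNat_natCast, add_zero, hxm0, hym0, abs_lt, rowMin, and_true]
    omega
  · intro s₁ ⟨h14, hm, h6, h23, h9⟩ hf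
    have e2 : s₁.reg 2 = 0 := by rw [hf 2 (by decide), h2]
    have e3 : s₁.reg 3 = 1 := by rw [hf 3 (by decide), h3]
    refine (Spec.loop h6 (fun j s' => s'.reg 14 = rowMin u c i j ∧ s'.mem = s.mem ∧
      s'.reg 23 = (x + j : ℕ) ∧ s'.reg 9 = (y + j : ℕ)) ⟨h14, hm, h23, h9⟩ ?_).mono le_rfl
      (fun s' h => ⟨h.1, h.2.1⟩)
    intro j hj s' ⟨k14, km, k23, k9⟩ kf k6
    have k2 : s'.reg 2 = 0 := by rw [kf 2 (by decide), e2]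
    have k3 : s'.reg 3 = 1 := by rw [kf 3 (by decide), e3]
    have hu0 := abs_le.1 (hu j hj)
    have hc0 := abs_le.1 (hc j hj)
    have hr := abs_le.1 (abs_rowMin_le hj.le hn hu hc)
    have hxm0 := hxm j hj
    have hym0 := hym j hj
    refine .of_wp ?_ (by decide)
    simp only [minStep, wp, Store.setReg, Function.update_apply, Nat.reduceEqDiff, if_true,
      if_false, k2, k3, k6, k14, km, k23, k9, Int.toNat_natCast, hxm0, hym0, abs_lt, rowMin, and_true,
      true_and, sub_zero]
    omega

/-- The entry of the upper bound matrix in the memory `M`. -/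
def entryU (n : ℕ) (M : ℕ → ℤ) (i j : ℕ) : ℤ := M (i * n + j)

/-- The entry of the matrix of window sums in the memory `M`. -/
def entryS (m n : ℕ) (M : ℕ → ℤ) (i j : ℕ) : ℤ := M (m * n + (i * (n - 1) + j))

/-- The entry `a` if `i + j` is odd, and its distance to the upper bound if `i + j` is even. -/
def reflect (U : ℕ → ℕ → ℤ) (a : ℕ → ℕ → ℤ) (i j : ℕ) : ℤ :=
  if Even (i + j) then U i j - a i j else a i j

/-- The reflected particular solution. -/
def start (m n : ℕ) (M : ℕ → ℤ) : ℕ → ℕ → ℤ :=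
  reflect (entryU n M) (particular (entryS m n M))

/-- The column offsets in the course of the computation: after `t` rounds and `k` rows. -/
def columnOffsets (m n : ℕ) (M : ℕ → ℤ) (t k : ℕ) : ℕ → ℤ :=
  relaxRows n (start m n M) (entryU n M) (offsets n (start m n M) (entryU n M) m t) k

/-- `H` bounds all numbers that the program stores. -/
structure Small (m n : ℕ) (M : ℕ → ℤ) (H : ℤ) : Prop where
  -- With `m * n` as unit, `U` starts at 0, `S` at 1, `u` at 2 and the column offsets at 3; they are
  -- followed by one row of `particular`. All addresses stay below 8 units.
  addr : ((8 * (m * n) : ℕ) : ℤ) ≤ H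
  mem : ∀ a, |M a| ≤ H
  -- The cases `j = n` here and `i = m` in `part` occur because the program computes one pair sum
  -- per row and one row of `particular` more than it needs.
  pair : ∀ i < m, ∀ j ≤ n, |pairSum (entryS m n M) i j| ≤ H
  part : ∀ i ≤ m, ∀ j < n, |particular (entryS m n M) i j| ≤ H
  start : ∀ i < m, ∀ j < n, |start m n M i j| ≤ H
  offset : ∀ t ≤ n, ∀ k ≤ m, ∀ j < n, |columnOffsets m n M t k j| ≤ H

/-- A matrix, read row by row. -/
def linear (n : ℕ) (f : ℕ → ℕ → ℤ) (x : ℕ) : ℤ := f (x / n) (x % n)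

theorem linear_apply {n : ℕ} (f : ℕ → ℕ → ℤ) {i j : ℕ} (hj : j < n) :
    linear n f (i * n + j) = f i j := by
  have h1 : (i * n + j) / n = i := by
    rw [mul_comm, Nat.mul_add_div (by omega), Nat.div_eq_of_lt hj, add_zero]
  have h2 : (i * n + j) % n = j := by
    rw [mul_comm, Nat.mul_add_mod, Nat.mod_eq_of_lt hj]
  rw [linear, h1, h2]

theorem row_le {m n i : ℕ} (hi : i < m) : i * n + n ≤ m * n := by
  rw [← Nat.succ_mul]
  exact Nat.mul_le_mul_right n hi

/-- The sign of a matrix position. -/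
def sign (k : ℕ) : ℤ := if Even k then 1 else -1

theorem sign_succ (k : ℕ) : sign (k + 1) = -sign k := by
  by_cases h : Even k <;> simp [sign, h, Nat.even_add_one]

theorem sign_abs (k : ℕ) : -1 ≤ sign k ∧ sign k ≤ 1 := by
  by_cases h : Even k <;> simp [sign, h]

/-- The program negates a sign register at every step, so a positivity test decides the parity of `i
+ j`. -/
theorem ite_sign (k : ℕ) (a b : ℤ) :
    (if 0 < sign k then a else b) = if Even k then a else b := by
  by_cases h : Even k <;> simp [sign, h]

/-! #### The particular solution -/

/-- Loop body: write an entry of the reflected particular solution. -/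
def fillStep : Cmd :=
  load 15 10 ;; load 16 7 ;; add 17 15 2 ;; subIf 12 17 16 15 ;; store 8 17 ;; sub 17 18 15 ;;
  store 10 17 ;; load 17 11 ;; sub 18 17 18 ;; add 10 10 3 ;; add 7 7 3 ;; add 8 8 3 ;;
  add 11 11 3 ;; sub 12 2 12 ;; sub 6 6 3

/-- Write a row of the reflected particular solution. -/
def fillRow : Cmd :=
  (add 12 13 2 ;; sub 13 2 13 ;; const 18 0 ;; add 10 20 2 ;; add 6 1 2) ;; loop 6 fillStep ;;
  -- The pointer into `S` has advanced `n` times, but a row of `S` has `n - 1` entries.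
  (sub 11 11 3 ;; sub 5 5 3)

/-- The memory after `j` entries of row `i` of the particular solution have been written. -/
structure FillMem (m n : ℕ) (M : ℕ → ℤ) (i j : ℕ) (mem : ℕ → ℤ) : Prop where
  input : ∀ a < 2 * (m * n), mem a = M a
  done : ∀ x < i * n + j, mem (2 * (m * n) + x) = linear n (start m n M) x
  offset : ∀ k < n, mem (3 * (m * n) + k) = 0
  row : ∀ k < n, mem (3 * (m * n) + n + k) =
    if k < j then particular (entryS m n M) (i + 1) k else particular (entryS m n M) i k

theorem FillMem.succ_row {m n : ℕ} {M : ℕ → ℤ} {i : ℕ} {mem : ℕ → ℤ}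
    (h : FillMem m n M i n mem) : FillMem m n M (i + 1) 0 mem where
  input := h.input
  done x hx := h.done x (by rw [Nat.succ_mul] at hx; omega)
  offset := h.offset
  row k hk := by rw [h.row k hk, if_pos hk, if_neg (by omega)]

/-- A single auxiliary row suffices: an entry of the next row needs only the pair sum and the entry
above, which it overwrites. -/
theorem FillMem.step {m n : ℕ} {M : ℕ → ℤ} {i j : ℕ} {mem : ℕ → ℤ}
    (h : FillMem m n M i j mem) (hi : i < m) (hj : j < n) {v v' : ℤ} (hv : v = start m n M i j)
    (hv' : v' = particular (entryS m n M) (i + 1) j) :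
    FillMem m n M i (j + 1) (Function.update (Function.update mem (2 * (m * n) + (i * n + j)) v)
      (3 * (m * n) + n + j) v') := by
  have hrow := row_le (n := n) hi
  refine ⟨fun a ha => ?_, fun x hx => ?_, fun k hk => ?_, fun k hk => ?_⟩ <;>
    simp only [Function.update_apply]
  · rw [if_neg (by omega), if_neg (by omega), h.input a ha]
  · rw [if_neg (by omega)]
    rcases (by omega : x < i * n + j ∨ x = i * n + j) with hx | rfl
    · rw [if_neg (by omega), h.done x hx]
    · rw [if_pos rfl, linear_apply _ hj, hv]
  · rw [if_neg (by omega), if_neg (by omega), h.offset k hk]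
  · by_cases hkj : k = j
    · subst hkj
      rw [if_pos rfl, if_pos (by omega), hv']
    · rw [if_neg (by omega), if_neg (by omega), h.row k hk]
      by_cases hlt : k < j
      · rw [if_pos hlt, if_pos (by omega)]
      · rw [if_neg hlt, if_neg (by omega)]

/-- The store after `j` entries of row `i` of the particular solution have been written. -/
def FillInv (m n : ℕ) (M : ℕ → ℤ) (i j : ℕ) (s : Store) : Prop :=
  s.reg 7 = (i * n + j : ℕ) ∧ s.reg 8 = (2 * (m * n) + (i * n + j) : ℕ) ∧
    s.reg 10 = (3 * (m * n) + n + j : ℕ) ∧ s.reg 11 = (m * n + (i * (n - 1) + j) : ℕ) ∧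
    s.reg 12 = sign (i + j) ∧ s.reg 18 = pairSum (entryS m n M) i j ∧ FillMem m n M i j s.mem

theorem fillStep_spec {B H : ℤ} {m n i j : ℕ} {M : ℕ → ℤ} {s : Store} (hi : i < m) (hj : j < n)
    (hB : 8 * H < B) (hM : Small m n M H) (h2 : s.reg 2 = 0) (h3 : s.reg 3 = 1)
    (h6 : s.reg 6 = (n : ℤ) - j) (hs : FillInv m n M i j s) :
    fillStep.Spec B s 17 (fun s' => FillInv m n M i (j + 1) s' ∧ s'.reg 6 = s.reg 6 - 1) := by
  have hrow := row_le (n := n) hi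
  have hSi : i * (n - 1) ≤ i * n := Nat.mul_le_mul_left i (Nat.sub_le n 1)
  obtain ⟨h7, h8, h10, h11, h12, h18, hm⟩ := hs
  have l1 : s.mem (3 * (m * n) + n + j) = particular (entryS m n M) i j := by
    rw [hm.row j hj, if_neg (lt_irrefl j)]
  have l2 : s.mem (i * n + j) = M (i * n + j) := hm.input _ (by omega)
  have l3 : s.mem (m * n + (i * (n - 1) + j)) = M (m * n + (i * (n - 1) + j)) :=
    hm.input _ (by omega)
  -- The entry of `S` is loaded after both stores, which must not have touched its cell.
  have n1 : ¬ m * n + (i * (n - 1) + j) = 3 * (m * n) + n + j := by omega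
  have n2 : ¬ m * n + (i * (n - 1) + j) = 2 * (m * n) + (i * n + j) := by omega
  have hstep := hm.step hi hj
    (v := if Even (i + j) then M (i * n + j) - particular (entryS m n M) i j
      else particular (entryS m n M) i j)
    (v' := pairSum (entryS m n M) i j - particular (entryS m n M) i j) rfl rfl
  have hpair : M (m * n + (i * (n - 1) + j)) - pairSum (entryS m n M) i j =
    pairSum (entryS m n M) i (j + 1) := rfl
  refine .of_wp ?_ (by decide)
  simp only [fillStep, FillInv, wp, Store.setReg, Store.setMem, Nat.reduceEqDiff, if_true,
    if_false, h2, h3, h6, h7, h8, h10, h11, h12, h18, Int.toNat_natCast, l1, l2, l3, n1, n2,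
    abs_lt, and_true, add_zero, zero_sub, Function.update_apply, ite_sign,
    ← add_assoc i j 1, sign_succ, hstep, hpair]
  have haddr := hM.addr
  have b1 := abs_le.1 (hM.part i hi.le j hj)
  have b2 := abs_le.1 (hM.pair i hi j hj.le)
  have b3 := abs_le.1 (hM.mem (i * n + j))
  have b5 := sign_abs (i + j)
  have b6 := abs_le.1 (hM.pair i hi (j + 1) hj)
  clear n1 n2 l1 l2 l3 h2 h3 h6 h7 h8 h10 h11 h12 h18 hpair
  omega

theorem fillRow_spec {B H : ℤ} {m n i : ℕ} {M : ℕ → ℤ} {s : Store} (hn : 0 < n) (hi : i < m)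
    (hB : 8 * H < B) (hM : Small m n M H)
    (h1 : s.reg 1 = n) (h2 : s.reg 2 = 0) (h3 : s.reg 3 = 1) (h5 : s.reg 5 = (m : ℤ) - i)
    (h7 : s.reg 7 = (i * n : ℕ)) (h8 : s.reg 8 = (2 * (m * n) + i * n : ℕ))
    (h11 : s.reg 11 = (m * n + i * (n - 1) : ℕ)) (h13 : s.reg 13 = sign i)
    (h20 : s.reg 20 = (3 * (m * n) + n : ℕ)) (hmem : FillMem m n M i 0 s.mem) :
    fillRow.Spec B s (19 * n + 9) (fun s' =>
      s'.reg 7 = ((i + 1) * n : ℕ) ∧ s'.reg 8 = (2 * (m * n) + (i + 1) * n : ℕ) ∧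
      s'.reg 11 = (m * n + (i + 1) * (n - 1) : ℕ) ∧ s'.reg 13 = sign (i + 1) ∧
      s'.reg 5 = s.reg 5 - 1 ∧ FillMem m n M (i + 1) 0 s'.mem) := by
  have hrow := row_le (n := n) hi
  have haddr := hM.addr
  have hmn : m ≤ m * n := Nat.le_mul_of_pos_right m hn
  have hSi : i * (n - 1) ≤ i * n := Nat.mul_le_mul_left i (Nat.sub_le n 1)
  refine (Spec.seq (T := 5) (T' := n * (17 + 2) + 2 + 2)
    (Q := fun s' => s'.reg 12 = sign i ∧ s'.reg 13 = sign (i + 1) ∧ s'.reg 18 = 0 ∧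
      s'.reg 10 = (3 * (m * n) + n : ℕ) ∧ s'.reg 6 = n ∧ s'.mem = s.mem)
      (.of_wp ?_ (by decide)) ?_).weaken (by omega)
  · have := sign_abs i
    simp only [wp, Store.setReg, Function.update_apply, Nat.reduceEqDiff, if_true, if_false,
      h1, h2, h13, h20, add_zero, zero_sub, abs_lt, sign_succ, and_true]
    omega
  intro s₁ ⟨h12, h13, h18, h10, h6, hm⟩ hf
  refine Spec.seq (Spec.loop h6 (FillInv m n M i)
    ⟨by rw [hf 7 (by decide), h7]; rfl, by rw [hf 8 (by decide), h8]; rfl, h10,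
      by rw [hf 11 (by decide), h11]; rfl, h12, h18, hm ▸ hmem⟩ ?_) ?_
  · intro j hj s' hs kf k6
    exact fillStep_spec hi hj hB hM (by rw [kf 2 (by decide), hf 2 (by decide), h2])
      (by rw [kf 3 (by decide), hf 3 (by decide), h3]) k6 hs
  · intro s₂ ⟨k7, k8, _, k11, _, _, km⟩ hf₂
    have f3 : s₂.reg 3 = 1 := by rw [hf₂ 3 (by decide), hf 3 (by decide), h3]
    have f5 : s₂.reg 5 = s.reg 5 := by rw [hf₂ 5 (by decide), hf 5 (by decide)]
    have f13 : s₂.reg 13 = sign (i + 1) := by rw [hf₂ 13 (by decide), h13]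
    have hn1 : ((n - 1 : ℕ) : ℤ) = n - 1 := by omega
    refine .of_wp ?_ (by decide)
    simp only [wp, Store.setReg, Nat.reduceEqDiff, if_true, if_false, f3, f5, h5, k7, k8, k11, f13,
      Function.update_apply, abs_lt, km.succ_row, and_true, true_and, Nat.succ_mul]
    refine ⟨by omega, by omega, ?_⟩
    push_cast
    rw [hn1]
    ring

theorem loop_fillRow_spec {B H : ℤ} {m n : ℕ} {M : ℕ → ℤ} {s : Store} (hn : 0 < n)
    (hB : 8 * H < B) (hM : Small m n M H)
    (h1 : s.reg 1 = n) (h2 : s.reg 2 = 0) (h3 : s.reg 3 = 1) (h5 : s.reg 5 = m)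
    (h7 : s.reg 7 = 0) (h8 : s.reg 8 = (2 * (m * n) : ℕ))
    (h11 : s.reg 11 = (m * n : ℕ)) (h13 : s.reg 13 = 1)
    (h20 : s.reg 20 = (3 * (m * n) + n : ℕ)) (hmem : FillMem m n M 0 0 s.mem) :
    (loop 5 fillRow).Spec B s (m * (19 * n + 9 + 2) + 2) (fun s' => FillMem m n M m 0 s'.mem) := by
  refine (Spec.loop h5 (fun i s' => s'.reg 7 = (i * n : ℕ) ∧
    s'.reg 8 = (2 * (m * n) + i * n : ℕ) ∧ s'.reg 11 = (m * n + i * (n - 1) : ℕ) ∧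
    s'.reg 13 = sign i ∧ FillMem m n M i 0 s'.mem)
    ⟨by simpa using h7, by simpa using h8, by simpa using h11, by simpa [sign] using h13, hmem⟩
    ?_).mono le_rfl (fun s' h => h.2.2.2.2)
  intro i hi s' ⟨k7, k8, k11, k13, km⟩ kf k5
  refine (fillRow_spec hn hi hB hM (by rw [kf 1 (by decide), h1]) (by rw [kf 2 (by decide), h2])
    (by rw [kf 3 (by decide), h3]) k5 k7 k8 k11 k13 (by rw [kf 20 (by decide), h20]) km).mono
    le_rfl ?_
  exact fun s'' ⟨l7, l8, l11, l13, l5, lm⟩ => ⟨⟨l7, l8, l11, l13, lm⟩, l5⟩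

/-! #### The relaxation -/

/-- Loop body: relax the constraints of a column. -/
def relaxStep : Cmd :=
  load 15 8 ;; sub 15 14 15 ;; load 16 7 ;; add 15 15 16 ;; load 16 9 ;; sub 17 16 15 ;;
  subIf 17 16 15 2 ;; store 9 16 ;; add 7 7 3 ;; add 8 8 3 ;; add 9 9 3 ;; sub 6 6 3

/-- Relax the constraints of a row. -/
def relaxRowCmd : Cmd :=
  minRow ;; (add 9 19 2 ;; add 6 1 2) ;; loop 6 relaxStep ;; sub 5 5 3

/-- A round of relaxation. -/
def roundCmd : Cmd :=
  (const 7 0 ;; add 8 4 4 ;; add 5 0 2) ;; loop 5 relaxRowCmd ;; sub 21 21 3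

/-- The memory during the relaxation, with column offsets `c`. -/
structure RelaxMem (m n : ℕ) (M : ℕ → ℤ) (c : ℕ → ℤ) (mem : ℕ → ℤ) : Prop where
  input : ∀ x < m * n, mem x = M x
  start : ∀ x < m * n, mem (2 * (m * n) + x) = linear n (start m n M) x
  offset : ∀ k < n, mem (3 * (m * n) + k) = c k

theorem FillMem.relaxMem {m n : ℕ} {M : ℕ → ℤ} {mem : ℕ → ℤ} (h : FillMem m n M m 0 mem) :
    RelaxMem m n M 0 mem where
  input x hx := h.input x (by omega)
  start x hx := h.done x hx
  offset := h.offset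

theorem RelaxMem.start_apply {m n : ℕ} {M c mem : ℕ → ℤ} (h : RelaxMem m n M c mem) {i j : ℕ}
    (hi : i < m) (hj : j < n) : mem (2 * (m * n) + (i * n + j)) = WindowSums.start m n M i j := by
  have := row_le (n := n) hi
  rw [h.start _ (by omega), linear_apply _ hj]

theorem RelaxMem.congr {m n : ℕ} {M c c' mem : ℕ → ℤ} (h : RelaxMem m n M c mem)
    (hc : ∀ j < n, c j = c' j) : RelaxMem m n M c' mem where
  input := h.input
  start := h.start
  offset k hk := by rw [h.offset k hk, hc k hk]

/-- The column offsets `c` with the first `j` of them replaced by those of `c'`. -/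
def splice (c c' : ℕ → ℤ) (j k : ℕ) : ℤ := if k < j then c' k else c k

theorem RelaxMem.step {m n : ℕ} {M c c' mem : ℕ → ℤ} {j : ℕ}
    (h : RelaxMem m n M (splice c c' j) mem) (hj : j < n) {v : ℤ} (hv : v = c' j) :
    RelaxMem m n M (splice c c' (j + 1)) (Function.update mem (3 * (m * n) + j) v) := by
  refine ⟨fun a ha => ?_, fun x hx => ?_, fun k hk => ?_⟩ <;> simp only [Function.update_apply]
  · rw [if_neg (by omega), h.input a ha]
  · rw [if_neg (by omega), h.start x hx]
  · by_cases hkj : k = j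
    · subst hkj
      rw [if_pos rfl, splice, if_pos (by omega), hv]
    · rw [if_neg (by omega), h.offset k hk, splice, splice]
      by_cases hlt : k < j
      · rw [if_pos hlt, if_pos (by omega)]
      · rw [if_neg hlt, if_neg (by omega)]

/-- The row minimum is fixed before any offset changes, so updating in place gives a `splice` of old
and new offsets. -/
theorem relaxRowCmd_spec {B H : ℤ} {m n i : ℕ} {M c : ℕ → ℤ} {s : Store} (hn : 0 < n) (hi : i < m)
    (hB : 8 * H < B) (hM : Small m n M H) (hc : ∀ j < n, |c j| ≤ H)
    (h1 : s.reg 1 = n) (h2 : s.reg 2 = 0) (h3 : s.reg 3 = 1) (h5 : s.reg 5 = (m : ℤ) - i)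
    (h7 : s.reg 7 = (i * n : ℕ)) (h8 : s.reg 8 = (2 * (m * n) + i * n : ℕ))
    (h19 : s.reg 19 = (3 * (m * n) : ℕ)) (hmem : RelaxMem m n M c s.mem) :
    relaxRowCmd.Spec B s (28 * n + 13) (fun s' =>
      s'.reg 7 = ((i + 1) * n : ℕ) ∧ s'.reg 8 = (2 * (m * n) + (i + 1) * n : ℕ) ∧
      s'.reg 5 = s.reg 5 - 1 ∧
      RelaxMem m n M (relaxRow n (start m n M) (entryU n M) i c) s'.mem) := by
  have hrow := row_le (n := n) hi
  have haddr := hM.addr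
  have hmn : m ≤ m * n := Nat.le_mul_of_pos_right m hn
  refine (Spec.seq (minRow_spec hn hB (hM.start i hi) hc (by omega) (by omega) h1 h2 h3 h8 h19
    (fun j hj => by rw [add_assoc]; exact hmem.start_apply hi hj) hmem.offset)
    (T' := 2 + (n * (14 + 2) + 2 + 1)) ?_).weaken (by omega)
  intro s₀ ⟨h14, hm₀⟩ hf₀
  refine Spec.seq (Q := fun s' => s'.reg 9 = (3 * (m * n) : ℕ) ∧ s'.reg 6 = n ∧ s'.mem = s.mem)
    (.of_wp ?_ (by decide)) ?_
  · simp only [wp, Store.setReg, Function.update_apply, Nat.reduceEqDiff, if_true, if_false,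
      hf₀ 1 (by decide), hf₀ 2 (by decide), hf₀ 19 (by decide), h1, h2, h19, add_zero, abs_lt,
      and_true, hm₀]
    omega
  intro s₁ ⟨h9, h6, hm⟩ hf
  have e2 : s₁.reg 2 = 0 := by rw [hf 2 (by decide), hf₀ 2 (by decide), h2]
  have e3 : s₁.reg 3 = 1 := by rw [hf 3 (by decide), hf₀ 3 (by decide), h3]
  have e5 : s₁.reg 5 = s.reg 5 := by rw [hf 5 (by decide), hf₀ 5 (by decide)]
  have e7 : s₁.reg 7 = (i * n : ℕ) := by rw [hf 7 (by decide), hf₀ 7 (by decide), h7]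
  have e8 : s₁.reg 8 = (2 * (m * n) + i * n : ℕ) := by
    rw [hf 8 (by decide), hf₀ 8 (by decide), h8]
  have e14 : s₁.reg 14 = rowMin (start m n M) c i n := by rw [hf 14 (by decide), h14]
  refine Spec.seq (Spec.loop h6 (fun j s' =>
    s'.reg 7 = (i * n + j : ℕ) ∧ s'.reg 8 = (2 * (m * n) + (i * n + j) : ℕ) ∧
    s'.reg 9 = (3 * (m * n) + j : ℕ) ∧
    RelaxMem m n M (splice c (relaxRow n (start m n M) (entryU n M) i c) j) s'.mem)
    ⟨e7, e8, h9, hm ▸ hmem⟩ ?_) ?_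
  · intro j hj s' ⟨k7, k8, k9, km⟩ kf k6
    have k2 : s'.reg 2 = 0 := by rw [kf 2 (by decide), e2]
    have k3 : s'.reg 3 = 1 := by rw [kf 3 (by decide), e3]
    have k14 : s'.reg 14 = rowMin (start m n M) c i n := by rw [kf 14 (by decide), e14]
    have b1 := abs_le.1 (hM.start i hi j hj)
    have b2 := abs_le.1 (abs_rowMin_le le_rfl hn (hM.start i hi) hc)
    have b3 := abs_le.1 (hM.mem (i * n + j))
    have b4 := abs_le.1 (hc j hj)
    have l1 := km.start_apply hi hj
    have l2 : s'.mem (i * n + j) = M (i * n + j) := km.input _ (by omega)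
    have l3 : s'.mem (3 * (m * n) + j) = c j := by
      rw [km.offset j hj, splice, if_neg (lt_irrefl j)]
    -- The conditional assignment computes the minimum in `relaxRow`; a positive difference means a
    -- violated constraint.
    have hstep := km.step hj
      (v := if 0 < c j - (rowMin (start m n M) c i n - start m n M i j + M (i * n + j)) then
        rowMin (start m n M) c i n - start m n M i j + M (i * n + j) else c j)
      (by rw [relaxRow, entryU]; omega)
    refine .of_wp ?_ (by decide)
    simp only [relaxStep, wp, Store.setReg, Store.setMem, Nat.reduceEqDiff, if_true,
      if_false, k2, k3, k6, k7, k8, k9, k14, Int.toNat_natCast, l1, l2, l3,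
      abs_lt, and_true, sub_zero, Function.update_apply, hstep]
    omega
  · intro s₂ ⟨h7, h8, _, hm⟩ hf
    have f3 : s₂.reg 3 = 1 := by rw [hf 3 (by decide), e3]
    have f5 : s₂.reg 5 = s.reg 5 := by rw [hf 5 (by decide), e5]
    have hm' := hm.congr (c' := relaxRow n (start m n M) (entryU n M) i c)
      (fun j hj => by rw [splice, if_pos hj])
    refine .of_wp ?_ (by decide)
    simp only [wp, Store.setReg, Nat.reduceEqDiff, if_true, if_false, f3, f5, h5, h7, h8,
      Function.update_apply, abs_lt, hm', and_true, Nat.succ_mul]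
    omega

theorem roundCmd_spec {B H : ℤ} {m n t : ℕ} {M : ℕ → ℤ} {s : Store} (hn : 0 < n) (hm : 0 < m)
    (hB : 8 * H < B) (hM : Small m n M H) (ht : t < n) (h0 : s.reg 0 = m)
    (h1 : s.reg 1 = n) (h2 : s.reg 2 = 0) (h3 : s.reg 3 = 1) (h4 : s.reg 4 = (m * n : ℕ))
    (h19 : s.reg 19 = (3 * (m * n) : ℕ)) (h21 : s.reg 21 = (n : ℤ) - t)
    (hmem : RelaxMem m n M (offsets n (start m n M) (entryU n M) m t) s.mem) :
    roundCmd.Spec B s (m * (28 * n + 15) + 6) (fun s' => s'.reg 21 = s.reg 21 - 1 ∧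
      RelaxMem m n M (offsets n (start m n M) (entryU n M) m (t + 1)) s'.mem) := by
  have haddr := hM.addr
  have hmn : m ≤ m * n := Nat.le_mul_of_pos_right m hn
  have hnm : n ≤ m * n := Nat.le_mul_of_pos_left n hm
  refine (Spec.seq (T := 3) (T' := m * (28 * n + 13 + 2) + 2 + 1) (Q := fun s' =>
    s'.reg 7 = 0 ∧ s'.reg 8 = (2 * (m * n) : ℕ) ∧ s'.reg 5 = m ∧ s'.mem = s.mem)
    (.of_wp ?_ (by decide)) ?_).weaken (by rw [add_assoc (28 * n)]; omega)
  · simp only [wp, Store.setReg, Function.update_apply, Nat.reduceEqDiff, if_true, if_false,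
      h0, h2, h4, add_zero, abs_lt, and_true, true_and]
    omega
  intro s₁ ⟨h7, h8, h5, hm₁⟩ hf
  refine Spec.seq (Spec.loop h5 (fun i s' => s'.reg 7 = (i * n : ℕ) ∧
    s'.reg 8 = (2 * (m * n) + i * n : ℕ) ∧ RelaxMem m n M (columnOffsets m n M t i) s'.mem)
    ⟨by simpa using h7, by simpa using h8, hm₁ ▸ hmem⟩ (T := 28 * n + 13) ?_) ?_
  · intro i hi s' ⟨k7, k8, km⟩ kf k5
    refine (relaxRowCmd_spec hn hi hB hM (hM.offset t ht.le i hi.le)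
      (by rw [kf 1 (by decide), hf 1 (by decide), h1])
      (by rw [kf 2 (by decide), hf 2 (by decide), h2])
      (by rw [kf 3 (by decide), hf 3 (by decide), h3]) k5 k7 k8
      (by rw [kf 19 (by decide), hf 19 (by decide), h19]) km).mono le_rfl ?_
    exact fun s'' ⟨l7, l8, l5, lm⟩ => ⟨⟨l7, l8, lm⟩, l5⟩
  · intro s₂ ⟨_, _, hm₂⟩ hf₂
    have f3 : s₂.reg 3 = 1 := by rw [hf₂ 3 (by decide), hf 3 (by decide), h3]
    have f21 : s₂.reg 21 = s.reg 21 := by rw [hf₂ 21 (by decide), hf 21 (by decide)]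
    refine .of_wp ?_ (by decide)
    simp only [wp, Store.setReg, if_true, f3, f21, h21, Function.update_apply, abs_lt, true_and]
    exact ⟨by omega, hm₂⟩

theorem loop_roundCmd_spec {B H : ℤ} {m n : ℕ} {M : ℕ → ℤ} {s : Store} (hn : 0 < n) (hm : 0 < m)
    (hB : 8 * H < B) (hM : Small m n M H) (h0 : s.reg 0 = m)
    (h1 : s.reg 1 = n) (h2 : s.reg 2 = 0) (h3 : s.reg 3 = 1) (h4 : s.reg 4 = (m * n : ℕ))
    (h19 : s.reg 19 = (3 * (m * n) : ℕ)) (h21 : s.reg 21 = n) (hmem : RelaxMem m n M 0 s.mem) :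
    (loop 21 roundCmd).Spec B s (n * (m * (28 * n + 15) + 6 + 2) + 2) (fun s' =>
      RelaxMem m n M (offsets n (start m n M) (entryU n M) m n) s'.mem) := by
  refine Spec.loop h21 (fun t s' =>
    RelaxMem m n M (offsets n (start m n M) (entryU n M) m t) s'.mem) hmem ?_
  intro t ht s' km kf k21
  exact (roundCmd_spec hn hm hB hM ht (by rw [kf 0 (by decide), h0]) (by rw [kf 1 (by decide), h1])
    (by rw [kf 2 (by decide), h2]) (by rw [kf 3 (by decide), h3]) (by rw [kf 4 (by decide), h4])
    (by rw [kf 19 (by decide), h19]) k21 km).mono le_rfl (fun _ h => ⟨h.2, h.1⟩)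

end WindowSums

namespace WindowSums

open Cmd

/-! #### The output -/

/-- The entries of `u` with the column offsets `c` added and the row minima subtracted. -/
def slack (n : ℕ) (u : ℕ → ℕ → ℤ) (c : ℕ → ℤ) (i j : ℕ) : ℤ := u i j + c j - rowMin u c i n

/-- Loop body: write an entry of the result. -/
def outStep : Cmd :=
  load 15 8 ;; load 16 9 ;; add 15 15 16 ;; sub 15 15 14 ;; load 16 7 ;; sub 17 15 16 ;;
  subIf 17 22 2 2 ;; subIf 12 15 16 15 ;; store 7 15 ;; add 7 7 3 ;; add 8 8 3 ;; add 9 9 3 ;;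
  sub 12 2 12 ;; sub 6 6 3

/-- Write a row of the result. -/
def outRow : Cmd :=
  minRow ;; (add 12 13 2 ;; sub 13 2 13 ;; add 9 19 2 ;; add 6 1 2) ;; loop 6 outStep ;; sub 5 5 3

/-- The memory after the first `l` entries of the result have been written. -/
structure OutMem (m n : ℕ) (M c : ℕ → ℤ) (l : ℕ) (mem : ℕ → ℤ) : Prop where
  output : ∀ x < l, mem x =
    linear n (reflect (entryU n M) (slack n (start m n M) c)) x
  input : ∀ x < m * n, l ≤ x → mem x = M x
  start : ∀ x < m * n, mem (2 * (m * n) + x) = linear n (start m n M) x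
  offset : ∀ k < n, mem (3 * (m * n) + k) = c k

/-- Register `22` is `1` as long as no entry of the result violates the bounds. -/
def Flag (m n : ℕ) (M c : ℕ → ℤ) (l : ℕ) (b : ℤ) : Prop :=
  (b = 1 ∧ ∀ x < l, linear n (slack n (start m n M) c) x ≤ M x) ∨
    (b = 0 ∧ ∃ x < l, M x < linear n (slack n (start m n M) c) x)

theorem RelaxMem.outMem {m n : ℕ} {M c mem : ℕ → ℤ} (h : RelaxMem m n M c mem) :
    OutMem m n M c 0 mem where
  output x hx := by omega
  input x hx _ := h.input x hx
  start := h.start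
  offset := h.offset

theorem OutMem.start_apply {m n l : ℕ} {M c mem : ℕ → ℤ} (h : OutMem m n M c l mem) {i j : ℕ}
    (hi : i < m) (hj : j < n) : mem (2 * (m * n) + (i * n + j)) = WindowSums.start m n M i j := by
  have := row_le (n := n) hi
  rw [h.start _ (by omega), linear_apply _ hj]

/-- The result overwrites `U`: each bound is read just before its cell is replaced and is not needed
again. -/
theorem OutMem.step {m n i j : ℕ} {M c mem : ℕ → ℤ} (h : OutMem m n M c (i * n + j) mem)
    (hi : i < m) (hj : j < n) {v : ℤ}
    (hv : v = reflect (entryU n M) (slack n (WindowSums.start m n M) c) i j) :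
    OutMem m n M c (i * n + j + 1) (Function.update mem (i * n + j) v) := by
  have hrow := row_le (n := n) hi
  refine ⟨fun x hx => ?_, fun x hx hl => ?_, fun x hx => ?_, fun k hk => ?_⟩ <;>
    simp only [Function.update_apply]
  · rcases (by omega : x < i * n + j ∨ x = i * n + j) with hx | rfl
    · rw [if_neg (by omega), h.output x hx]
    · rw [if_pos rfl, linear_apply _ hj, hv]
  · rw [if_neg (by omega), h.input x hx (by omega)]
  · rw [if_neg (by omega), h.start x hx]
  · rw [if_neg (by omega), h.offset k hk]

/-- Only the upper bound is tested, as subtracting the row minimum makes every slack nonnegative. A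
violation is never forgotten. -/
theorem Flag.step {m n i j : ℕ} {M c : ℕ → ℤ} {b : ℤ} (h : Flag m n M c (i * n + j) b)
    (hj : j < n) :
    Flag m n M c (i * n + j + 1)
      (if 0 < slack n (start m n M) c i j - M (i * n + j) then 0 else b) := by
  have hl := linear_apply (slack n (start m n M) c) (i := i) hj
  by_cases hlt : 0 < slack n (start m n M) c i j - M (i * n + j)
  · rw [if_pos hlt]
    exact .inr ⟨rfl, i * n + j, by omega, by rw [hl]; omega⟩
  · rw [if_neg hlt]
    rcases h with ⟨hb, h⟩ | ⟨hb, x, hx, h⟩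
    · refine .inl ⟨hb, fun x hx => ?_⟩
      rcases (by omega : x < i * n + j ∨ x = i * n + j) with hx | rfl
      · exact h x hx
      · rw [hl]; omega
    · exact .inr ⟨hb, x, by omega, h⟩

/-- The store after `j` entries of row `i` of the result have been written. -/
def OutInv (m n : ℕ) (M c : ℕ → ℤ) (i j : ℕ) (s : Store) : Prop :=
  s.reg 7 = (i * n + j : ℕ) ∧ s.reg 8 = (2 * (m * n) + (i * n + j) : ℕ) ∧
    s.reg 9 = (3 * (m * n) + j : ℕ) ∧ s.reg 12 = sign (i + j) ∧
    Flag m n M c (i * n + j) (s.reg 22) ∧ OutMem m n M c (i * n + j) s.mem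

theorem outStep_spec {B H : ℤ} {m n i j : ℕ} {M c : ℕ → ℤ} {s : Store} (hi : i < m) (hj : j < n)
    (hB : 8 * H < B) (hM : Small m n M H) (hc : ∀ j < n, |c j| ≤ H)
    (h2 : s.reg 2 = 0) (h3 : s.reg 3 = 1) (h6 : s.reg 6 = (n : ℤ) - j)
    (h14 : s.reg 14 = rowMin (start m n M) c i n) (hs : OutInv m n M c i j s) :
    outStep.Spec B s 18 (fun s' => OutInv m n M c i (j + 1) s' ∧ s'.reg 6 = s.reg 6 - 1) := by
  have hrow := row_le (n := n) hi
  obtain ⟨h7, h8, h9, h12, h22, hm⟩ := hs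
  have l1 := hm.start_apply hi hj
  have l2 : s.mem (i * n + j) = M (i * n + j) := hm.input _ (by omega) le_rfl
  have l3 := hm.offset j hj
  have hslack : start m n M i j + c j - rowMin (start m n M) c i n =
    slack n (start m n M) c i j := rfl
  have hflag := h22.step hj
  have hstep := hm.step hi hj
    (v := if Even (i + j) then M (i * n + j) - slack n (start m n M) c i j
      else slack n (start m n M) c i j) rfl
  refine .of_wp ?_ (by decide)
  simp only [outStep, OutInv, wp, Store.setReg, Store.setMem, Nat.reduceEqDiff, if_true,
    if_false, h2, h3, h6, h7, h8, h9, h12, h14, Int.toNat_natCast, l1, l2, l3, hslack,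
    abs_lt, and_true, sub_zero, zero_sub, Function.update_apply, ite_sign,
    ← add_assoc i j 1, ← add_assoc (i * n) j 1, sign_succ, hstep, hflag]
  have haddr := hM.addr
  have b1 := abs_le.1 (hM.start i hi j hj)
  have b2 := abs_le.1 (abs_rowMin_le le_rfl (by omega) (hM.start i hi) hc)
  have b3 := abs_le.1 (hM.mem (i * n + j))
  have b4 := abs_le.1 (hc j hj)
  have b5 := sign_abs (i + j)
  clear l1 l2 l3 h2 h3 h6 h7 h8 h9 h12 h14 h22
  omega

theorem outRow_spec {B H : ℤ} {m n i : ℕ} {M c : ℕ → ℤ} {s : Store} (hn : 0 < n) (hi : i < m)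
    (hB : 8 * H < B) (hM : Small m n M H) (hc : ∀ j < n, |c j| ≤ H)
    (h1 : s.reg 1 = n) (h2 : s.reg 2 = 0) (h3 : s.reg 3 = 1) (h5 : s.reg 5 = (m : ℤ) - i)
    (h7 : s.reg 7 = (i * n : ℕ)) (h8 : s.reg 8 = (2 * (m * n) + i * n : ℕ))
    (h13 : s.reg 13 = sign i) (h19 : s.reg 19 = (3 * (m * n) : ℕ))
    (h22 : Flag m n M c (i * n) (s.reg 22)) (hmem : OutMem m n M c (i * n) s.mem) :
    outRow.Spec B s (32 * n + 15) (fun s' =>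
      s'.reg 7 = ((i + 1) * n : ℕ) ∧ s'.reg 8 = (2 * (m * n) + (i + 1) * n : ℕ) ∧
      s'.reg 13 = sign (i + 1) ∧ s'.reg 5 = s.reg 5 - 1 ∧
      Flag m n M c ((i + 1) * n) (s'.reg 22) ∧ OutMem m n M c ((i + 1) * n) s'.mem) := by
  have hrow := row_le (n := n) hi
  have haddr := hM.addr
  have hmn : m ≤ m * n := Nat.le_mul_of_pos_right m hn
  refine (Spec.seq (minRow_spec hn hB (hM.start i hi) hc (by omega) (by omega) h1 h2 h3 h8 h19
    (fun j hj => by rw [add_assoc]; exact hmem.start_apply hi hj) hmem.offset)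
    (T' := 4 + (n * (18 + 2) + 2 + 1)) ?_).weaken (by omega)
  intro s₀ ⟨h14, hm₀⟩ hf₀
  refine Spec.seq (Q := fun s' => s'.reg 12 = sign i ∧ s'.reg 13 = sign (i + 1) ∧
    s'.reg 9 = (3 * (m * n) : ℕ) ∧ s'.reg 6 = n ∧ s'.mem = s.mem) (.of_wp ?_ (by decide)) ?_
  · have := sign_abs i
    simp only [wp, Store.setReg, Function.update_apply, Nat.reduceEqDiff, if_true, if_false,
      hf₀ 1 (by decide), hf₀ 2 (by decide), hf₀ 13 (by decide), hf₀ 19 (by decide), h1, h2, h13,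
      h19, add_zero, zero_sub, sign_succ, abs_lt, and_true, hm₀]
    omega
  intro s₁ ⟨h12, h13, h9, h6, hm⟩ hf
  refine Spec.seq (Spec.loop h6 (OutInv m n M c i)
    ⟨by rw [hf 7 (by decide), hf₀ 7 (by decide), h7]; rfl,
      by rw [hf 8 (by decide), hf₀ 8 (by decide), h8]; rfl, h9, h12,
      by rw [hf 22 (by decide), hf₀ 22 (by decide)]; exact h22, hm ▸ hmem⟩ ?_) ?_
  · intro j hj s' hs kf k6
    exact outStep_spec hi hj hB hM hc
      (by rw [kf 2 (by decide), hf 2 (by decide), hf₀ 2 (by decide), h2])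
      (by rw [kf 3 (by decide), hf 3 (by decide), hf₀ 3 (by decide), h3]) k6
      (by rw [kf 14 (by decide), hf 14 (by decide), h14]) hs
  · intro s₂ ⟨k7, k8, _, _, k22, km⟩ hf₂
    have f3 : s₂.reg 3 = 1 := by
      rw [hf₂ 3 (by decide), hf 3 (by decide), hf₀ 3 (by decide), h3]
    have f5 : s₂.reg 5 = s.reg 5 := by
      rw [hf₂ 5 (by decide), hf 5 (by decide), hf₀ 5 (by decide)]
    have f13 : s₂.reg 13 = sign (i + 1) := by rw [hf₂ 13 (by decide), h13]
    refine .of_wp ?_ (by decide)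
    simp only [wp, Store.setReg, Nat.reduceEqDiff, if_true, if_false, f3, f5, h5, k7, k8, f13,
      Function.update_apply, abs_lt, km, k22, and_true, Nat.succ_mul]
    omega

/-! #### The whole program -/

/-- Write the result and put the answer into register `0`. -/
def outCmd : Cmd :=
  (const 22 1 ;; const 7 0 ;; add 8 4 4 ;; const 13 1 ;; add 5 0 2) ;; loop 5 outRow ;; add 0 22 2

/-- Compute the addresses. -/
def setupCmd : Cmd :=
  (const 3 1 ;; add 6 0 2) ;; loop 6 (add 4 4 1 ;; sub 6 6 3) ;;
  (add 11 4 2 ;; add 8 4 4 ;; add 19 8 4 ;; add 20 19 1 ;; const 13 1 ;; add 5 0 2)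

/-- The program without its final `halt`. -/
def mainCmd : Cmd :=
  setupCmd ;; loop 5 fillRow ;; add 21 1 2 ;; loop 21 roundCmd ;; outCmd

theorem outCmd_spec {B H : ℤ} {m n : ℕ} {M c : ℕ → ℤ} {s : Store} (hn : 0 < n) (hm : 0 < m)
    (hB : 8 * H < B) (hM : Small m n M H) (hc : ∀ j < n, |c j| ≤ H) (h0 : s.reg 0 = m)
    (h1 : s.reg 1 = n) (h2 : s.reg 2 = 0) (h3 : s.reg 3 = 1) (h4 : s.reg 4 = (m * n : ℕ))
    (h19 : s.reg 19 = (3 * (m * n) : ℕ)) (hmem : RelaxMem m n M c s.mem) :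
    outCmd.Spec B s (m * (32 * n + 17) + 8) (fun s' =>
      Flag m n M c (m * n) (s'.reg 0) ∧ OutMem m n M c (m * n) s'.mem) := by
  have haddr := hM.addr
  have hmn : m ≤ m * n := Nat.le_mul_of_pos_right m hn
  refine (Spec.seq (T := 5) (T' := m * (32 * n + 15 + 2) + 2 + 1) (Q := fun s' =>
    s'.reg 22 = 1 ∧ s'.reg 7 = 0 ∧ s'.reg 8 = (2 * (m * n) : ℕ) ∧ s'.reg 13 = 1 ∧ s'.reg 5 = m ∧
    s'.mem = s.mem) (.of_wp ?_ (by decide)) ?_).weaken (by rw [add_assoc (32 * n)]; omega)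
  · simp only [wp, Store.setReg, Function.update_apply, Nat.reduceEqDiff, if_true, if_false,
      h0, h2, h4, add_zero, abs_lt, and_true, true_and]
    omega
  intro s₁ ⟨h22, h7, h8, h13, h5, hm₁⟩ hf
  refine Spec.seq (Spec.loop h5 (fun i s' => s'.reg 7 = (i * n : ℕ) ∧
    s'.reg 8 = (2 * (m * n) + i * n : ℕ) ∧ s'.reg 13 = sign i ∧
    Flag m n M c (i * n) (s'.reg 22) ∧ OutMem m n M c (i * n) s'.mem)
    ⟨by simpa using h7, by simpa using h8, by simpa [sign] using h13,
      .inl ⟨h22, fun x hx => by omega⟩, by rw [hm₁, zero_mul]; exact hmem.outMem⟩ ?_) ?_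
  · intro i hi s' ⟨k7, k8, k13, k22, km⟩ kf k5
    refine (outRow_spec hn hi hB hM hc
      (by rw [kf 1 (by decide), hf 1 (by decide), h1])
      (by rw [kf 2 (by decide), hf 2 (by decide), h2])
      (by rw [kf 3 (by decide), hf 3 (by decide), h3]) k5 k7 k8 k13
      (by rw [kf 19 (by decide), hf 19 (by decide), h19]) k22 km).mono le_rfl ?_
    exact fun s'' ⟨l7, l8, l13, l5, l22, lm⟩ => ⟨⟨l7, l8, l13, l22, lm⟩, l5⟩
  · intro s₂ ⟨_, _, _, k22, km⟩ hf₂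
    have f2 : s₂.reg 2 = 0 := by rw [hf₂ 2 (by decide), hf 2 (by decide), h2]
    refine .of_wp ?_ (by decide)
    simp only [wp, Store.setReg, if_true, f2, add_zero, Function.update_apply, k22, km, and_true]
    rcases k22 with ⟨h, _⟩ | ⟨h, _⟩ <;> rw [h, abs_lt] <;> omega

theorem setupCmd_spec {B H : ℤ} {m n : ℕ} {M : ℕ → ℤ} {s : Store} (hn : 0 < n) (hm : 0 < m)
    (hB : 8 * H < B) (hM : Small m n M H) (h0 : s.reg 0 = m)
    (h1 : s.reg 1 = n) (h2 : s.reg 2 = 0) (h4 : s.reg 4 = 0) :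
    setupCmd.Spec B s (4 * m + 10) (fun s' => s'.mem = s.mem ∧ s'.reg 3 = 1 ∧
      s'.reg 4 = (m * n : ℕ) ∧ s'.reg 5 = m ∧ s'.reg 8 = (2 * (m * n) : ℕ) ∧
      s'.reg 11 = (m * n : ℕ) ∧ s'.reg 13 = 1 ∧ s'.reg 19 = (3 * (m * n) : ℕ) ∧
      s'.reg 20 = (3 * (m * n) + n : ℕ)) := by
  have haddr := hM.addr
  have hmn : m ≤ m * n := Nat.le_mul_of_pos_right m hn
  have hnm : n ≤ m * n := Nat.le_mul_of_pos_left n hm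
  refine (Spec.seq (T := 2) (T' := m * (2 + 2) + 2 + 6) (Q := fun s' =>
    s'.reg 3 = 1 ∧ s'.reg 6 = m ∧ s'.mem = s.mem) (.of_wp ?_ (by decide)) ?_).weaken (by omega)
  · simp only [wp, Store.setReg, Function.update_apply, Nat.reduceEqDiff, if_true, if_false,
      h0, h2, add_zero, abs_lt, and_true]
    omega
  intro s₁ ⟨h3, h6, hm₁⟩ hf
  refine Spec.seq (Spec.loop h6 (fun i s' => s'.reg 4 = (i * n : ℕ) ∧ s'.mem = s.mem)
    ⟨by rw [hf 4 (by decide), h4]; simp, hm₁⟩ ?_) ?_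
  · intro i hi s' ⟨k4, km⟩ kf k6
    have hrow := row_le (n := n) hi
    have k1 : s'.reg 1 = n := by rw [kf 1 (by decide), hf 1 (by decide), h1]
    have k3 : s'.reg 3 = 1 := by rw [kf 3 (by decide), h3]
    refine .of_wp ?_ (by decide)
    simp only [wp, Store.setReg, Nat.reduceEqDiff, if_true, if_false, k1, k3, k4, k6,
      Function.update_apply, abs_lt, km, and_true, Nat.succ_mul]
    omega
  · intro s₂ ⟨k4, km⟩ hf₂
    have f0 : s₂.reg 0 = m := by rw [hf₂ 0 (by decide), hf 0 (by decide), h0]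
    have f1 : s₂.reg 1 = n := by rw [hf₂ 1 (by decide), hf 1 (by decide), h1]
    have f2 : s₂.reg 2 = 0 := by rw [hf₂ 2 (by decide), hf 2 (by decide), h2]
    have f3 : s₂.reg 3 = 1 := by rw [hf₂ 3 (by decide), h3]
    refine .of_wp ?_ (by decide)
    simp only [wp, Store.setReg, Nat.reduceEqDiff, if_true, if_false, f0, f1, f2, f3, k4, km,
      Function.update_apply, abs_lt, true_and, add_zero]
    omega

theorem mainCmd_spec {B H : ℤ} {m n : ℕ} {M : ℕ → ℤ} {s : Store} (hn : 0 < n) (hm : 0 < m)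
    (hB : 8 * H < B) (hM : Small m n M H) (h0 : s.reg 0 = m)
    (h1 : s.reg 1 = n) (hs : ∀ r, 2 ≤ r → s.reg r = 0) (hmem : s.mem = M)
    (hfree : ∀ a, 2 * (m * n) ≤ a → M a = 0) :
    mainCmd.Spec B s (200 * (m * n * (m + n))) (fun s' =>
      Flag m n M (offsets n (start m n M) (entryU n M) m n) (m * n) (s'.reg 0) ∧
      OutMem m n M (offsets n (start m n M) (entryU n M) m n) (m * n) s'.mem) := by
  -- The rounds of relaxation contribute the dominant term `28 * m * n ^ 2`; all else is `O(mn)`.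
  have hT : 4 * m + 10 + (m * (19 * n + 9 + 2) + 2 + (1 + (n * (m * (28 * n + 15) + 6 + 2) + 2 +
      (m * (32 * n + 17) + 8)))) ≤ 200 * (m * n * (m + n)) := by
    have e1 : m ≤ m * n := Nat.le_mul_of_pos_right m hn
    have e2 : n ≤ m * n := Nat.le_mul_of_pos_left n hm
    have e3 : m * n ≤ m * n * m := Nat.le_mul_of_pos_right _ hm
    have e4 : m * n ≤ m * n * n := Nat.le_mul_of_pos_right _ hn
    nlinarith
  refine (Spec.seq (setupCmd_spec hn hm hB hM h0 h1 (hs 2 le_rfl) (hs 4 (by omega)))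
    ?_).weaken hT
  intro s₁ ⟨hm₁, h3, h4, h5, h8, h11, h13, h19, h20⟩ hf₁
  have a0 : s₁.reg 0 = m := by rw [hf₁ 0 (by decide), h0]
  have a1 : s₁.reg 1 = n := by rw [hf₁ 1 (by decide), h1]
  have a2 : s₁.reg 2 = 0 := by rw [hf₁ 2 (by decide), hs 2 le_rfl]
  refine Spec.seq (loop_fillRow_spec hn hB hM a1 a2 h3 h5
    (by rw [hf₁ 7 (by decide), hs 7 (by omega)]) h8 h11 h13 h20 ?_) ?_
  -- The initial offsets and row `0` of `particular` are zero, as is the memory beyond the input.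
  · rw [hm₁, hmem]
    refine ⟨fun _ _ => rfl, fun x hx => by omega, fun k _ => hfree _ (by omega), fun k _ => ?_⟩
    rw [hfree _ (by omega), if_neg (by omega), particular]
  intro s₂ hm₂ hf₂
  have b0 : s₂.reg 0 = m := by rw [hf₂ 0 (by decide), a0]
  have b1 : s₂.reg 1 = n := by rw [hf₂ 1 (by decide), a1]
  have b2 : s₂.reg 2 = 0 := by rw [hf₂ 2 (by decide), a2]
  have b3 : s₂.reg 3 = 1 := by rw [hf₂ 3 (by decide), h3]
  have b4 : s₂.reg 4 = (m * n : ℕ) := by rw [hf₂ 4 (by decide), h4]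
  have b19 : s₂.reg 19 = (3 * (m * n) : ℕ) := by rw [hf₂ 19 (by decide), h19]
  refine Spec.seq (Q := fun s' => s'.reg 21 = n ∧ s'.mem = s₂.mem) (.of_wp ?_ (by decide)) ?_
  · have haddr := hM.addr
    have hnm : n ≤ m * n := Nat.le_mul_of_pos_left n hm
    simp only [wp, Store.setReg, if_true, b1, b2, add_zero, Function.update_apply, abs_lt, and_true]
    omega
  intro s₃ ⟨h21, hm₃⟩ hf₃
  have c0 : s₃.reg 0 = m := by rw [hf₃ 0 (by decide), b0]
  have c1 : s₃.reg 1 = n := by rw [hf₃ 1 (by decide), b1]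
  have c2 : s₃.reg 2 = 0 := by rw [hf₃ 2 (by decide), b2]
  have c3 : s₃.reg 3 = 1 := by rw [hf₃ 3 (by decide), b3]
  have c4 : s₃.reg 4 = (m * n : ℕ) := by rw [hf₃ 4 (by decide), b4]
  have c19 : s₃.reg 19 = (3 * (m * n) : ℕ) := by rw [hf₃ 19 (by decide), b19]
  refine Spec.seq (loop_roundCmd_spec hn hm hB hM c0 c1 c2 c3 c4 c19 h21
    (hm₃ ▸ hm₂.relaxMem)) ?_
  intro s₄ hm₄ hf₄
  exact outCmd_spec hn hm hB hM (hM.offset n le_rfl 0 (Nat.zero_le m))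
    (by rw [hf₄ 0 (by decide), c0]) (by rw [hf₄ 1 (by decide), c1])
    (by rw [hf₄ 2 (by decide), c2]) (by rw [hf₄ 3 (by decide), c3])
    (by rw [hf₄ 4 (by decide), c4]) (by rw [hf₄ 19 (by decide), c19]) hm₄

end WindowSums

namespace WindowSums

open Cmd

/-! ### Correctness of the result -/

/-- The second reflection undoes the first and restores the alternating signs of the offsets, which
cancel in every window. -/
theorem reflect_slack (n : ℕ) (U a : ℕ → ℕ → ℤ) (c : ℕ → ℤ) (i j : ℕ) :
    reflect U (slack n (reflect U a) c) i j =
      a i j + (-1) ^ i * (-1) ^ j * (rowMin (reflect U a) c i n - c j) := by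
  rw [← pow_add]
  rcases Nat.even_or_odd (i + j) with h | h
  · rw [h.neg_one_pow, reflect, slack, if_pos h]
    nth_rw 1 [reflect]
    rw [if_pos h]
    ring
  · rw [h.neg_one_pow, reflect, slack, if_neg (Nat.not_even_iff_odd.2 h)]
    nth_rw 1 [reflect]
    rw [if_neg (Nat.not_even_iff_odd.2 h)]
    ring

theorem reflect_slack_window (n : ℕ) (U S : ℕ → ℕ → ℤ) (c : ℕ → ℤ) (i j : ℕ) :
    let A := reflect U (slack n (reflect U (particular S)) c)
    A i j + A (i + 1) j + A i (j + 1) + A (i + 1) (j + 1) = S i j := by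
  intro A
  rw [← particular_window (S := S) i j]
  simp only [A, reflect_slack, pow_succ]
  ring

theorem feasible_of_solution {m n : ℕ} {U S A : ℕ → ℕ → ℤ}
    (hA : ∀ i < m, ∀ j < n, 0 ≤ A i j ∧ A i j ≤ U i j)
    (hS : ∀ i j, i + 1 < m → j + 1 < n →
      A i j + A (i + 1) j + A i (j + 1) + A (i + 1) (j + 1) = S i j) :
    ∃ d, Feasible m n (reflect U (particular S)) U d := by
  let E : ℕ → ℕ → ℤ := fun i j => A i j - particular S i j
  have hE := alternating_offsets (m := m) (n := n) (E := E) fun i j hi hj => by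
    have h1 := hS i j hi hj
    have h2 := particular_window (S := S) i j
    simp only [E]
    linarith
  -- The middle expression is `U i j - A i j` at even positions and `A i j` at odd ones.
  have key : ∀ i < m, ∀ j < n,
      0 ≤ reflect U (particular S) i j + (E 0 0 - (-1) ^ j * E 0 j) - (-1) ^ i * E i 0 ∧
      reflect U (particular S) i j + (E 0 0 - (-1) ^ j * E 0 j) - (-1) ^ i * E i 0 ≤ U i j := by
    intro i hi j hj
    have h1 := hE i hi j hj
    have h2 := hA i hi j hj
    have h3 : E i j = A i j - particular S i j := rfl
    rcases Nat.even_or_odd (i + j) with h | h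
    · rw [h.neg_one_pow] at h1
      rw [reflect, if_pos h]
      constructor <;> linarith
    · rw [h.neg_one_pow] at h1
      rw [reflect, if_neg (Nat.not_even_iff_odd.2 h)]
      constructor <;> linarith
  refine ⟨fun j => E 0 0 - (-1) ^ j * E 0 j, fun i hi j hj j' hj' => ?_⟩
  have h1 := key i hi j hj
  have h2 := key i hi j' hj'
  dsimp only
  linarith

theorem slack_nonneg {n : ℕ} {u : ℕ → ℕ → ℤ} {c : ℕ → ℤ} {i j : ℕ} (hj : j < n) :
    0 ≤ slack n u c i j :=
  sub_nonneg.2 (rowMin_le hj)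

/-- If the row minimum is attained at `j'`, this is the constraint for the pair `j'`, `j`. -/
theorem Feasible.slack_le {m n : ℕ} {u U : ℕ → ℕ → ℤ} {c : ℕ → ℤ} (h : Feasible m n u U c)
    {i j : ℕ} (hi : i < m) (hj : j < n) : slack n u c i j ≤ U i j := by
  obtain ⟨j', hj', h'⟩ := rowMin_eq (u := u) c i le_rfl (show 0 < n by omega)
  have := h i hi j' hj' j hj
  rw [slack, h']
  linarith

/-! ### The input -/

section Input

variable {m n : ℕ} (U : Matrix (Fin m) (Fin n) ℤ) (S : Matrix (Fin (m + 1 - 2)) (Fin (n + 1 - 2)) ℤ)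

theorem entryU_inputMem {i j : ℕ} (hi : i < m) (hj : j < n) :
    entryU n (inputMem U S) i j = U ⟨i, hi⟩ ⟨j, hj⟩ := by
  have hlt : i * n + j < m * n := by have := row_le (n := n) hi; omega
  rw [entryU, inputMem, dif_pos hlt]
  congr 1
  · exact Fin.ext (by
      simp only [Fin.coe_divNat]
      rw [mul_comm, Nat.mul_add_div (by omega), Nat.div_eq_of_lt hj, add_zero])
  · exact Fin.ext (by
      simp only [Fin.coe_modNat]
      rw [mul_comm, Nat.mul_add_mod, Nat.mod_eq_of_lt hj])

theorem entryS_inputMem (i : Fin (m + 1 - 2)) (j : Fin (n + 1 - 2)) :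
    entryS m n (inputMem U S) i j = S i j := by
  have hi := i.2
  have hj := j.2
  have hrow := row_le (n := n + 1 - 2) hi
  have hn : n - 1 = n + 1 - 2 := by omega
  have hsub : m * n + ((i : ℕ) * (n - 1) + j) - m * n = i * (n + 1 - 2) + j := by
    rw [hn, Nat.add_sub_cancel_left]
  have hlt : m * n + ((i : ℕ) * (n - 1) + j) - m * n < (m + 1 - 2) * (n + 1 - 2) := by
    rw [hsub]; omega
  rw [entryS, inputMem, dif_neg (by omega), dif_pos hlt]
  congr 1
  · exact Fin.ext (by
      simp only [Fin.coe_divNat]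
      rw [hsub, mul_comm, Nat.mul_add_div (by omega), Nat.div_eq_of_lt hj, add_zero])
  · exact Fin.ext (by
      simp only [Fin.coe_modNat]
      rw [hsub, mul_comm, Nat.mul_add_mod, Nat.mod_eq_of_lt hj])

theorem le_maxAbs {k l : ℕ} (A : Matrix (Fin k) (Fin l) ℤ) (i : Fin k) (j : Fin l) :
    |A i j| ≤ maxAbs A := by
  have := Finset.le_sup (f := fun ij : Fin k × Fin l => (A ij.1 ij.2).natAbs)
    (Finset.mem_univ (i, j))
  rw [Int.abs_eq_natAbs]
  exact_mod_cast this

theorem abs_inputMem_le (a : ℕ) : |inputMem U S a| ≤ (maxAbs U + maxAbs S : ℕ) := by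
  unfold inputMem
  split_ifs with h h'
  · have := le_maxAbs U (Fin.divNat ⟨a, h⟩) (Fin.modNat ⟨a, h⟩)
    push_cast
    omega
  · have := le_maxAbs S (Fin.divNat ⟨a - m * n, h'⟩) (Fin.modNat ⟨a - m * n, h'⟩)
    push_cast
    omega
  · rw [abs_zero]
    positivity

theorem inputMem_eq_zero {a : ℕ} (ha : 2 * (m * n) ≤ a) : inputMem U S a = 0 := by
  have : (m + 1 - 2) * (n + 1 - 2) ≤ m * n := Nat.mul_le_mul (by omega) (by omega)
  rw [inputMem, dif_neg (by omega), dif_neg (by omega)]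

theorem windowSum_two_two (A : Matrix (Fin m) (Fin n) ℤ) (i : Fin (m + 1 - 2))
    (j : Fin (n + 1 - 2)) :
    windowSum 2 2 A i j = A ⟨i, by omega⟩ ⟨j, by omega⟩ + A ⟨i + 1, by omega⟩ ⟨j, by omega⟩ +
      A ⟨i, by omega⟩ ⟨j + 1, by omega⟩ + A ⟨i + 1, by omega⟩ ⟨j + 1, by omega⟩ := by
  simp only [windowSum, Fin.sum_univ_two, Fin.val_zero, Fin.val_one, add_zero]
  ring

/-! ### Size of the numbers -/

/-- All numbers in the computation are bounded by a power of the largest number in the input. -/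
theorem small_inputMem (hm : 0 < m) (hn : 0 < n) :
    Small m n (inputMem U S) (((m + n + maxAbs U + maxAbs S) ^ 10 : ℕ) : ℤ) := by
  obtain ⟨N, hN⟩ : ∃ N, N = m + n + maxAbs U + maxAbs S := ⟨_, rfl⟩
  rw [← hN]
  -- As `N ≥ 2`, constants are absorbed into powers of `N`. The offsets grow by at most `3 * N ^ 4`
  -- per row, over at most `N ^ 2 + N` rows, which `N ^ 10` covers.
  have hN2 : 2 ≤ N := by omega
  have hmN : m ≤ N := by omega
  have hnN : n ≤ N := by omega
  have hpow : ∀ {a b : ℕ}, a ≤ b → N ^ a ≤ N ^ b := fun h => Nat.pow_le_pow_right (by omega) h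
  have hmem : ∀ a, |inputMem U S a| ≤ (N : ℤ) := fun a =>
    (abs_inputMem_le U S a).trans (by exact_mod_cast (show maxAbs U + maxAbs S ≤ N by omega))
  have cast_le : ∀ {a b : ℕ}, a ≤ b → (a : ℤ) ≤ b := fun h => by exact_mod_cast h
  have hpair : ∀ i, ∀ j ≤ n, |pairSum (entryS m n (inputMem U S)) i j| ≤ ((N ^ 2 : ℕ) : ℤ) := by
    intro i j hj
    refine (abs_pairSum_le (fun j => hmem _) j).trans ?_
    rw [sq]
    exact_mod_cast Nat.mul_le_mul_right N (hj.trans hnN)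
  have hpart : ∀ i ≤ m, ∀ j < n,
      |particular (entryS m n (inputMem U S)) i j| ≤ ((N ^ 3 : ℕ) : ℤ) := by
    intro i hi j hj
    refine (abs_particular_le (fun i j => hmem _) i j).trans ?_
    have : i * (j * N) ≤ N ^ 3 := by
      rw [pow_succ', sq]
      exact Nat.mul_le_mul (hi.trans hmN) (Nat.mul_le_mul_right N (hj.le.trans hnN))
    exact_mod_cast this
  have hstart : ∀ i < m, ∀ j < n, |start m n (inputMem U S) i j| ≤ ((N ^ 4 : ℕ) : ℤ) := by
    intro i hi j hj
    have h1 := hpart i hi.le j hj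
    have h2 : |entryU n (inputMem U S) i j| ≤ (N : ℤ) := hmem _
    have h3 : N + N ^ 3 ≤ N ^ 4 := by
      have e1 : N ≤ N ^ 3 := Nat.le_self_pow (by omega) N
      have e2 : N ^ 3 * 2 ≤ N ^ 3 * N := Nat.mul_le_mul_left _ hN2
      rw [pow_succ N 3]
      omega
    have h4 := cast_le h3
    rw [Nat.cast_add] at h4
    rw [start, reflect]
    split_ifs
    · have := abs_sub (entryU n (inputMem U S) i j) (particular (entryS m n (inputMem U S)) i j)
      omega
    · omega
  have hoff : ∀ t ≤ n, ∀ k ≤ m, ∀ j < n,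
      |columnOffsets m n (inputMem U S) t k j| ≤ ((N ^ 10 : ℕ) : ℤ) := by
    intro t ht k hk j hj
    have hU : ∀ i < m, ∀ j < n, |entryU n (inputMem U S) i j| ≤ ((N ^ 4 : ℕ) : ℤ) :=
      fun i _ j _ => (hmem _).trans (cast_le (by simpa using hpow (show 1 ≤ 4 by omega)))
    refine (abs_relaxRows_le hn hstart hU (abs_offsets_le hn hstart hU t) hk j hj).trans ?_
    have h1 : t * (m * (3 * N ^ 4)) + k * (3 * N ^ 4) ≤ N ^ 10 := by
      have e1 : t * (m * (3 * N ^ 4)) ≤ N * (N * (3 * N ^ 4)) :=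
        Nat.mul_le_mul (ht.trans hnN) (Nat.mul_le_mul_right _ hmN)
      have e2 : k * (3 * N ^ 4) ≤ N * (3 * N ^ 4) := Nat.mul_le_mul_right _ (hk.trans hmN)
      have e3 : N * (N * (3 * N ^ 4)) = 3 * N ^ 6 := by ring
      have e4 : N * (3 * N ^ 4) = 3 * N ^ 5 := by ring
      have e5 : N ^ 5 ≤ N ^ 6 := hpow (by omega)
      have e6 : N ^ 6 * 2 ^ 4 ≤ N ^ 6 * N ^ 4 := Nat.mul_le_mul_left _ (Nat.pow_le_pow_left hN2 4)
      rw [← pow_add, show 6 + 4 = 10 from rfl] at e6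
      omega
    exact_mod_cast h1
  refine ⟨cast_le ?_, fun a => (hmem a).trans (cast_le ?_), fun i _ j hj =>
    (hpair i j hj).trans (cast_le (hpow (by omega))), fun i hi j hj =>
    (hpart i hi j hj).trans (cast_le (hpow (by omega))), fun i hi j hj =>
    (hstart i hi j hj).trans (cast_le (hpow (by omega))), hoff⟩
  · have e1 : 2 ^ 3 * (m * n) ≤ N ^ 3 * (N * N) :=
      Nat.mul_le_mul (Nat.pow_le_pow_left hN2 3) (Nat.mul_le_mul hmN hnN)
    have e2 : N ^ 3 * (N * N) = N ^ 5 := by ring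
    have e3 : N ^ 5 ≤ N ^ 10 := hpow (by omega)
    omega
  · simpa using hpow (show 1 ≤ 10 by omega)

/-- With flag `1`, both bounds and the window sums hold. With flag `0`, a solution would make the
constraints feasible, hence also the final offsets, and no slack could exceed its bound. -/
theorem answers_of_outMem (hn : 0 < n) {s : Store} (b : ℕ)
    (hflag : Flag m n (inputMem U S) (offsets n (start m n (inputMem U S))
      (entryU n (inputMem U S)) m n) (m * n) (s.reg 0))
    (hmem : OutMem m n (inputMem U S) (offsets n (start m n (inputMem U S))
      (entryU n (inputMem U S)) m n) (m * n) s.mem) : Answers U S (s.at b) := by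
  rcases hflag with ⟨h0, hle⟩ | ⟨h0, x, hx, hlt⟩
  · refine .inl ⟨h0, ?_⟩
    have hout : ∀ i (hi : i < m) j (hj : j < n), outputMatrix m n (s.at b) ⟨i, hi⟩ ⟨j, hj⟩ =
        reflect (entryU n (inputMem U S)) (slack n (start m n (inputMem U S))
          (offsets n (start m n (inputMem U S)) (entryU n (inputMem U S)) m n)) i j := by
      intro i hi j hj
      have hrow := row_le (n := n) hi
      rw [outputMatrix, Store.at]
      simp only
      rw [hmem.output _ (by omega), linear_apply _ hj]
    constructor
    · intro ⟨i, hi⟩ ⟨j, hj⟩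
      have hrow := row_le (n := n) hi
      have h1 := hle (i * n + j) (by omega)
      rw [linear_apply _ hj] at h1
      have h2 := slack_nonneg (u := start m n (inputMem U S)) (i := i)
        (c := offsets n (start m n (inputMem U S)) (entryU n (inputMem U S)) m n) hj
      have h3 : inputMem U S (i * n + j) = entryU n (inputMem U S) i j := rfl
      rw [hout, ← entryU_inputMem U S hi hj, reflect]
      split_ifs <;> constructor <;> linarith
    · ext i j
      rw [windowSum_two_two, hout, hout, hout, hout, ← entryS_inputMem U S i j]
      exact reflect_slack_window _ _ _ _ _ _
  · refine .inr ⟨h0, fun ⟨A, hA, hS⟩ => ?_⟩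
    have hi : x / n < m := Nat.div_lt_of_lt_mul (by rwa [mul_comm])
    have hj : x % n < n := Nat.mod_lt x hn
    have hfeas : Feasible m n (start m n (inputMem U S)) (entryU n (inputMem U S))
        (offsets n (start m n (inputMem U S)) (entryU n (inputMem U S)) m n) := by
      refine feasible_offsets hn (feasible_of_solution
        (A := fun i j => if h : i < m ∧ j < n then A ⟨i, h.1⟩ ⟨j, h.2⟩ else 0) ?_ ?_)
      · intro i hi j hj
        rw [dif_pos ⟨hi, hj⟩, entryU_inputMem U S hi hj]
        exact hA _ _
      · intro i j hi hj
        have h1 := entryS_inputMem U S ⟨i, by omega⟩ ⟨j, by omega⟩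
        rw [dif_pos ⟨by omega, by omega⟩, dif_pos ⟨by omega, by omega⟩,
          dif_pos ⟨by omega, by omega⟩, dif_pos ⟨by omega, by omega⟩]
        refine Eq.trans ?_ h1.symm
        rw [← hS, windowSum_two_two]
    have h1 := hfeas.slack_le hi hj
    have h2 : x / n * n + x % n = x := Nat.div_add_mod' x n
    rw [entryU, h2] at h1
    exact absurd hlt (not_lt.2 h1)

theorem mul_le_unaryLength : m * n ≤ unaryLength U S := by
  have : m * n ≤ ∑ i, ∑ j, ((U i j).natAbs + 1) := by
    calc m * n = ∑ _i : Fin m, ∑ _j : Fin n, 1 := by simp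
      _ ≤ _ := Finset.sum_le_sum fun i _ => Finset.sum_le_sum fun j _ => by omega
  rw [unaryLength]
  omega

end Input

/-! ### The compiled program and the final bounds -/

/-- The program: reduce the problem to difference constraints and relax them `n` times. -/
def program : Program := mainCmd.code 0 ++ [.halt]

theorem program_haltsIn {m n : ℕ} (hm : 0 < m) (hn : 0 < n) (U : Matrix (Fin m) (Fin n) ℤ)
    (S : Matrix (Fin (m + 1 - 2)) (Fin (n + 1 - 2)) ℤ) :
    ∃ T ≤ 200 * (m * n * (m + n)), ∃ c, HaltsIn program (14 * instanceBits U S)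
      (inputConfig U S) T c ∧ Answers U S c := by
  obtain ⟨N, hN⟩ : ∃ N, N = m + n + maxAbs U + maxAbs S := ⟨_, rfl⟩
  have hsmall := small_inputMem U S hm hn
  -- The exponent 14 leaves room for the factor 8, since `8 * N ^ 10 ≤ N ^ 14` for `N ≥ 2`.
  have hw : N ^ 14 < 2 ^ (14 * instanceBits U S) := by
    rw [instanceBits, ← hN, mul_comm, pow_mul]
    exact Nat.pow_lt_pow_left (Nat.lt_size_self N) (by omega)
  have hN14 : 8 * N ^ 10 ≤ N ^ 14 := by
    have e1 : N ^ 10 * 2 ^ 4 ≤ N ^ 10 * N ^ 4 :=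
      Nat.mul_le_mul_left _ (Nat.pow_le_pow_left (by omega) 4)
    rw [← pow_add, show 10 + 4 = 14 from rfl] at e1
    omega
  have hB : 8 * ((N ^ 10 : ℕ) : ℤ) < 2 ^ (14 * instanceBits U S) := by
    exact_mod_cast hN14.trans_lt hw
  rw [← hN] at hsmall
  let s : Store := ⟨(inputConfig U S).reg, (inputConfig U S).mem⟩
  have haddr := hsmall.addr
  have hmn : m ≤ m * n := Nat.le_mul_of_pos_right m hn
  have hnm : n ≤ m * n := Nat.le_mul_of_pos_left n hm
  have hs : s.Bounded (2 ^ (14 * instanceBits U S)) := by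
    refine ⟨fun r => ?_, fun a => ?_⟩
    · simp only [s, inputConfig]
      split_ifs <;> rw [abs_lt] <;> omega
    · have := hsmall.mem a
      simp only [s, inputConfig]
      omega
  obtain ⟨T, hT, s', he, hflag, hout⟩ := mainCmd_spec (s := s) hn hm hB hsmall rfl rfl
    (fun r hr => by
      simp only [s, inputConfig]
      rw [if_neg (by omega), if_neg (by omega)]) rfl (fun a => inputMem_eq_zero U S)
  have hcode : HasCode program 0 (mainCmd.code 0) := ⟨[], [.halt], rfl, rfl⟩
  have hr := he.reaches hs 0 hcode
  refine ⟨T, hT, s'.at (0 + mainCmd.len), ⟨hr.1, ?_, hr.2⟩, answers_of_outMem U S hn _ hflag hout⟩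
  have hlen := Cmd.length_code mainCmd 0
  rw [zero_add, Store.at, program]
  simp only
  rw [List.getElem?_append_right (by omega), hlen, Nat.sub_self]
  rfl

end WindowSums

theorem theorem2 :
    ∃ (p : WindowSums.Program) (C k : ℕ) (q : Polynomial ℕ),
      ∀ (m n : ℕ) (hm : 0 < m) (hn : 0 < n) (U : Matrix (Fin m) (Fin n) ℤ)
        (S : Matrix (Fin (m + 1 - 2)) (Fin (n + 1 - 2)) ℤ),
        ∃ (T : ℕ) (c : WindowSums.Config),
          WindowSums.HaltsIn p (k * WindowSums.instanceBits U S)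
            (WindowSums.inputConfig U S) T c ∧
          WindowSums.Answers U S c ∧
          T ≤ C * (m * n * (m + n) * (1 + (WindowSums.minEntry hm hn U).toNat)) ∧
          T ≤ q.eval (WindowSums.unaryLength U S) := by
  -- With `L` the unary length, `m * n ≤ L` and `m + n ≤ 2 * L` give `200 * L * (2 * L) = 400 * L ^
  -- 2`.
  refine ⟨WindowSums.program, 200, 14, 400 * Polynomial.X ^ 2, fun m n hm hn U S => ?_⟩
  obtain ⟨T, hT, c, hc, ha⟩ := WindowSums.program_haltsIn hm hn U S
  refine ⟨T, c, hc, ha, hT.trans ?_, hT.trans ?_⟩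
  -- The factor involving the least entry is at least 1 and can only enlarge the bound.
  · exact Nat.mul_le_mul_left _ (Nat.le_mul_of_pos_right _ (by omega))
  · have h1 := WindowSums.mul_le_unaryLength U S
    have hmn : m ≤ m * n := Nat.le_mul_of_pos_right m hn
    have hnm : n ≤ m * n := Nat.le_mul_of_pos_left n hm
    have h2 : m * n * (m + n) ≤
        WindowSums.unaryLength U S * (2 * WindowSums.unaryLength U S) :=
      Nat.mul_le_mul h1 (by omega)
    simp only [Polynomial.eval_mul, Polynomial.eval_pow, Polynomial.eval_X,
      Polynomial.eval_ofNat]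
    nlinarith
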